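/- **Setting (HPPK).** Let $p$ be a prime, $n_b,\lambda,m\ge 0$ integers and $n=n_b+\lambda$. A private key consists of integers $S,R_1,R_2$ (the homomorphic key) with $0\le R_z<S$, $\gcd(R_z,S)=1$ and $|S|_2>2|p|_2+|(n+1)m|_2$ (where $|\cdot|_2$ is the bit length), and of two polynomials $f_1,f_2\in\mathbb F_p[x]$ of degree at most $\lambda$. With a base polynomial $b=\sum_{j=1}^m b_j(x)x_j$, $b_j\in\mathbb F_p[x]$, $\deg b_j\le n_b$, it generates the cipher public key $(p,n,m,\mathcal P_1,\mathcal P_2)$, where $\mathcal P_z$ is the $(n+1)\times m$ integer matrix with entries $\mathcal P_{ijz}=R_z\,p_{ijz}\bmod S$ ($0\le i\le n$, $1\le j\le m$), and $p_{ijz}\in\{0,\dots,p-1\}$ represents the coefficient of $x^i$ in $b_jf_z$. Call $(S,R_1,R_2,f_1,f_2)$ a *private key of order at most $\lambda$* of a cipher public key if it generates this public key, for some base polynomial, with parameters $(n_b',\lambda')$ such that $\lambda'\le\lambda$ and $n_b'+\lambda'=n$; its part $(S,R_1,R_2)$ is then called a *homomorphic key* of the public key. **Lemma.** Let $\lambda\le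 2$. Finding a private key (of order at most $\lambda$) from the cipher public key reduces in polynomial time to finding a homomorphic key $S,R_1,R_2$. More precisely, every public key that has a private key has a homomorphic key, and there is a deterministic algorithm which, given a cipher public key and any homomorphic key $(S,R_1,R_2)$ of it, outputs a private key of it, in a number of bit operations that is bounded by a polynomial in the bit length of the input (the public key together with the homomorphic key). Moreover, if the public key was generated by $(S,R_1,R_2,f_1,f_2)$ with parameters $(n_b,\lambda)$ and a base polynomial $b\neq0$, and the algorithm is given the values $S,R_1,R_2$ that were used, then it outputs a private key $(S,R_1,R_2,g_1,g_2)$ for which $f_1=e\,g_1$ and $f_2=e\,g_2$ with some $e\in\mathbb F_p[x]$; if $f_1$ and $f_2$ are coprime, then $g_1=a f_1$ and $g_2=a f_2$ for some $a\in\mathbb F_p\setminus\{0\}$. -/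

import Mathlib

open Polynomial

/-! ## A machine model with bit cost

Programs of a random access machine whose memory consists of arrays of natural numbers of
arbitrary size. Every operation is charged according to the bit lengths of the numbers that it
handles, so that polynomial time here is the usual (Turing machine) polynomial time. -/

namespace RAM

/-- A memory: `s a i` is the content of cell `i` of array `a`. -/
abbrev Store : Type := ℕ → ℕ → ℕ

/-- The elementary operations on natural numbers. -/
inductive Op : Type
  | add | sub | mul | div | mod | eq | lt

/-- The value of an elementary operation (subtraction is truncated, a quotient by `0` is `0`,
a comparison yields `1` for true and `0` for false). -/
def Op.eval : Op → ℕ → ℕ → ℕ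
  | .add, x, y => x + y
  | .sub, x, y => x - y
  | .mul, x, y => x * y
  | .div, x, y => x / y
  | .mod, x, y => x % y
  | .eq, x, y => if x = y then 1 else 0
  | .lt, x, y => if x < y then 1 else 0

/-- Expressions: constants, reading a cell at a computed address, elementary operations. -/
inductive Expr : Type
  | lit (k : ℕ)
  | load (a : ℕ) (i : Expr)
  | binop (o : Op) (e₁ e₂ : Expr)

/-- The value of an expression. -/
def Expr.eval (s : Store) : Expr → ℕ
  | .lit k => k
  | .load a i => s a (i.eval s)
  | .binop o e₁ e₂ => o.eval (e₁.eval s) (e₂.eval s)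

/-- The bit cost of evaluating an expression; an elementary operation on numbers of bit lengths
`u` and `v` costs `(u + v + 1) ^ 2`. -/
def Expr.cost (s : Store) : Expr → ℕ
  | .lit k => k.size + 1
  | .load a i => i.cost s + (i.eval s).size + (s a (i.eval s)).size + 1
  | .binop _ e₁ e₂ =>
      e₁.cost s + e₂.cost s + ((e₁.eval s).size + (e₂.eval s).size + 1) ^ 2

/-- Programs: no operation, `a[i] := e`, composition, branching and iteration (`0` is false). -/
inductive Cmd : Type
  | skip
  | store (a : ℕ) (i e : Expr)
  | seq (c₁ c₂ : Cmd)
  | cond (e : Expr) (c₁ c₂ : Cmd)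
  | loop (e : Expr) (c : Cmd)

/-- `s` with the cell `i` of array `a` overwritten by `v`. -/
def Store.write (s : Store) (a i v : ℕ) : Store :=
  Function.update s a (Function.update (s a) i v)

/-- `Exec c s t s'`: started in memory `s`, the program `c` halts in memory `s'`,
at total cost `t`. -/
inductive Exec : Cmd → Store → ℕ → Store → Prop
  | skip (s : Store) : Exec .skip s 1 s
  | store (a : ℕ) (i e : Expr) (s : Store) :
      Exec (.store a i e) s
        (i.cost s + e.cost s + (i.eval s).size + (e.eval s).size + 1)
        (s.write a (i.eval s) (e.eval s))
  | seq {c₁ c₂ : Cmd} {s s' s'' : Store} {t₁ t₂ : ℕ}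
      (h₁ : Exec c₁ s t₁ s') (h₂ : Exec c₂ s' t₂ s'') :
      Exec (.seq c₁ c₂) s (t₁ + t₂) s''
  | cond_true {e : Expr} {c₁ c₂ : Cmd} {s s' : Store} {t : ℕ}
      (he : e.eval s ≠ 0) (h : Exec c₁ s t s') :
      Exec (.cond e c₁ c₂) s (e.cost s + t + 1) s'
  | cond_false {e : Expr} {c₁ c₂ : Cmd} {s s' : Store} {t : ℕ}
      (he : e.eval s = 0) (h : Exec c₂ s t s') :
      Exec (.cond e c₁ c₂) s (e.cost s + t + 1) s'
  | loop_stop {e : Expr} {c : Cmd} {s : Store} (he : e.eval s = 0) :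
      Exec (.loop e c) s (e.cost s + 1) s
  | loop_step {e : Expr} {c : Cmd} {s s' s'' : Store} {t₁ t₂ : ℕ}
      (he : e.eval s ≠ 0) (h₁ : Exec c s t₁ s') (h₂ : Exec (.loop e c) s' t₂ s'') :
      Exec (.loop e c) s (e.cost s + t₁ + t₂ + 1) s''

/-- The array that holds a finite list, its length being stored in cell `0`. -/
def arrayOf (l : List ℕ) : ℕ → ℕ := fun i => (l.length :: l).getD i 0

/-- The bit length of a list of natural numbers (with one separator for each entry). -/
def bitLength (l : List ℕ) : ℕ := (l.map fun a => a.size + 1).sum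

/-- The initial memory: the two inputs stand in the arrays `0` and `1`, all else is `0`. -/
def initStore (x y : List ℕ) : Store := fun a =>
  if a = 0 then arrayOf x else if a = 1 then arrayOf y else fun _ => 0

/-- On the inputs `x`, `y`, the program `c` halts at cost at most `t` with the output list `z`
(preceded by its length) in array `2`. -/
def ComputesWithin (c : Cmd) (x y z : List ℕ) (t : ℕ) : Prop :=
  ∃ t' s', Exec c (initStore x y) t' s' ∧ t' ≤ t ∧ ∀ i ≤ z.length, s' 2 i = arrayOf z i

end RAM

/-! ## Search problems and reductions -/

/-- A search problem over a type of instances: the candidate solutions of each instance, the way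
they are written down, and which of the candidates are solutions. -/
structure SearchProblem (I : Type) where
  Sol : I → Type
  encodeSol : ∀ x, Sol x → List ℕ
  IsSol : ∀ x, Sol x → Prop

/-- The program `c`, running within the time bound `q`, reduces the search problem `A` to the
search problem `B`: every instance `x` that is solvable for `A` is solvable for `B`, and from `x`
and *any* solution of `B` for `x` the program computes a solution of `A` for `x`, at a cost of at
most `q` of the bit length of its input. -/
def ReducesBy {I : Type} (encodeInst : I → List ℕ) (c : RAM.Cmd) (q : Polynomial ℕ)
    (A B : SearchProblem I) : Prop :=
  (∀ x, (∃ a, A.IsSol x a) → ∃ b, B.IsSol x b) ∧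
  ∀ x b, B.IsSol x b → ∃ a, A.IsSol x a ∧
    RAM.ComputesWithin c (encodeInst x) (B.encodeSol x b) (A.encodeSol x a)
      (q.eval (RAM.bitLength (encodeInst x) + RAM.bitLength (B.encodeSol x b)))

/-! ## The HPPK cryptosystem

The indices `1` and `2` of `R_1`, `R_2`, `f_1`, `f_2` and of the two polynomials of the central map
are the elements `0` and `1` of `Fin 2`. -/

namespace HPPK

/-- The homomorphic encryption operator on a plain coefficient: `R * a mod S`. -/
def encrypt (R S a : ℕ) : ℕ := R * a % S

/-- The coefficient of `x ^ i * x_j` in the plain polynomial `p_z = b * f_z`, where the base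
polynomial is `b(x, x_1, …, x_m) = ∑ j, b j (x) * x_j`. -/
noncomputable def plainCoeff {p m : ℕ} (b : Fin m → (ZMod p)[X]) (f : Fin 2 → (ZMod p)[X])
    (z : Fin 2) (i : ℕ) (j : Fin m) : ZMod p :=
  (b j * f z).coeff i

/-- The data of a cipher public key: the prime `p`, the degree `n` in the message variable, the
number `m` of noise variables, and the two `(n + 1) × m` matrices of cipher coefficients. -/
structure PublicKey where
  p : ℕ
  n : ℕ
  m : ℕ
  P : Fin 2 → Matrix (Fin (n + 1)) (Fin m) ℕ

/-- The data of a homomorphic key: `S`, `R_1`, `R_2`. -/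
structure HomKey where
  S : ℕ
  R : Fin 2 → ℕ

/-- The data of a private key: `S`, `R_1`, `R_2`, `f_1`, `f_2`. -/
structure PrivateKey (p : ℕ) extends HomKey where
  f : Fin 2 → (ZMod p)[X]

/-- `pk` is the cipher public key that key generation with the orders `nb` and `lam` produces
from the private key `κ` and the base polynomial `b`. -/
structure IsGeneratedBy (pk : PublicKey) (nb lam : ℕ) (κ : PrivateKey pk.p)
    (b : Fin pk.m → (ZMod pk.p)[X]) : Prop where
  prime : pk.p.Prime
  order : nb + lam = pk.n
  natDegree_b : ∀ j, (b j).natDegree ≤ nb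
  natDegree_f : ∀ z, (κ.f z).natDegree ≤ lam
  size_S : 2 * pk.p.size + ((pk.n + 1) * pk.m).size < κ.S.size
  R_lt : ∀ z, κ.R z < κ.S
  coprime : ∀ z, (κ.R z).Coprime κ.S
  cipher : ∀ z i j, pk.P z i j = encrypt (κ.R z) κ.S (plainCoeff b κ.f z i j).val

/-- `κ` is a private key of `pk`, of order at most `lam`: key generation with the private key `κ`,
for some base polynomial, produces `pk`. -/
def IsPrivateKey (lam : ℕ) (pk : PublicKey) (κ : PrivateKey pk.p) : Prop :=
  ∃ lam' ≤ lam, ∃ nb b, IsGeneratedBy pk nb lam' κ b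

/-- `h` is a homomorphic key of `pk`: the part `S`, `R_1`, `R_2` of a private key of `pk`. -/
def IsHomKey (lam : ℕ) (pk : PublicKey) (h : HomKey) : Prop :=
  ∃ f : Fin 2 → (ZMod pk.p)[X], IsPrivateKey lam pk ⟨h, f⟩

/-- The entries of a public key, written down as a list of numbers. -/
def PublicKey.encode (pk : PublicKey) : List ℕ :=
  [pk.p, pk.n, pk.m] ++
    (List.finRange 2).flatMap fun z =>
      (List.finRange (pk.n + 1)).flatMap fun i =>
        (List.finRange pk.m).map fun j => pk.P z i j

/-- `S`, `R_1`, `R_2` as a list of numbers. -/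
def HomKey.encode (h : HomKey) : List ℕ := [h.S, h.R 0, h.R 1]

/-- `S`, `R_1`, `R_2`, and the coefficients of `f_1` and `f_2` up to `x ^ lam`, each represented
by its least non-negative residue, as a list of numbers. -/
noncomputable def PrivateKey.encode (lam : ℕ) {p : ℕ} (κ : PrivateKey p) : List ℕ :=
  κ.toHomKey.encode ++
    (List.finRange 2).flatMap fun z =>
      (List.range (lam + 1)).map fun i => ((κ.f z).coeff i).val

/-- Given a cipher public key, find a private key (of order at most `lam`) for it. -/
noncomputable def privateKeyProblem (lam : ℕ) : SearchProblem PublicKey where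
  Sol pk := PrivateKey pk.p
  encodeSol _ κ := κ.encode lam
  IsSol pk κ := IsPrivateKey lam pk κ

/-- Given a cipher public key, find a homomorphic key `S`, `R_1`, `R_2` for it. -/
def homKeyProblem (lam : ℕ) : SearchProblem PublicKey where
  Sol _ := HomKey
  encodeSol _ h := h.encode
  IsSol pk h := IsHomKey lam pk h

end HPPK

/-! A homomorphic key undoes the encryption: `R_z` is invertible modulo `S`, and `p < S`, so
multiplying a cipher entry by the inverse returns the exact residue of the plain coefficient. A
column `j` with a nonzero entry thus reveals `u = b_j f_1` and `v = b_j f_2`, not both zero. Only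
the ratio `f_1 : f_2` matters, so one such column suffices and nothing has to be factored.

The extended Euclidean algorithm on `u, v` keeps two rows `F 0 = F 1 * u + F 2 * v` whose cofactor
matrix has a nonzero constant determinant. When one row reaches `F 0 = 0`, its cofactors are coprime
and `F 1 * u + F 2 * v = 0`. Cancelling `b_j` shows that `g = (F 2, -F 1)` is a coprime pair in the
ratio of `f`, so `f = e g` by Bézout. Moving `e` into the base polynomial makes `g` a private key,
of order lowered by `deg e` (`IsGeneratedBy.exists_eq_mul`). If all entries vanish, `g = 0` works
(`IsGeneratedBy.completes_zero`).

For the running time it suffices to count steps and to bound the numbers written: a step of a fixed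
program costs quadratically in the bit length (`Cmd.exists_cost_le`). The integer Euclidean loop is
logarithmic because a product of remainders halves; the polynomial one takes at most `2 W` rounds
because a sum of lengths drops each time. The algorithmic core is `reaches_extract`. -/

namespace RAM

/-! ## Counting steps instead of bits -/

/-- `Steps L c s k s'`: started in `s`, the program `c` halts in `s'` after `k` elementary steps,
and every number that it writes is less than `2 ^ L`. -/
inductive Steps (L : ℕ) : Cmd → Store → ℕ → Store → Prop
  | skip (s : Store) : Steps L .skip s 1 s
  | store (a : ℕ) (i e : Expr) (s : Store) (h : e.eval s < 2 ^ L) :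
      Steps L (.store a i e) s 1 (s.write a (i.eval s) (e.eval s))
  | seq {c₁ c₂ : Cmd} {s s' s'' : Store} {k₁ k₂ : ℕ}
      (h₁ : Steps L c₁ s k₁ s') (h₂ : Steps L c₂ s' k₂ s'') :
      Steps L (.seq c₁ c₂) s (k₁ + k₂) s''
  | cond_true {e : Expr} {c₁ c₂ : Cmd} {s s' : Store} {k : ℕ}
      (he : e.eval s ≠ 0) (h : Steps L c₁ s k s') : Steps L (.cond e c₁ c₂) s (k + 1) s'
  | cond_false {e : Expr} {c₁ c₂ : Cmd} {s s' : Store} {k : ℕ}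
      (he : e.eval s = 0) (h : Steps L c₂ s k s') : Steps L (.cond e c₁ c₂) s (k + 1) s'
  | loop_exit {e : Expr} {c : Cmd} {s : Store} (he : e.eval s = 0) : Steps L (.loop e c) s 1 s
  | loop_step {e : Expr} {c : Cmd} {s s' s'' : Store} {k₁ k₂ : ℕ}
      (he : e.eval s ≠ 0) (h₁ : Steps L c s k₁ s') (h₂ : Steps L (.loop e c) s' k₂ s'') :
      Steps L (.loop e c) s (k₁ + k₂ + 1) s''

/-- All cells of `s` hold numbers of bit length at most `L`. -/
def Store.Bounded (L : ℕ) (s : Store) : Prop := ∀ a i, (s a i).size ≤ L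

theorem Store.write_apply (s : Store) (a i v a' i' : ℕ) :
    s.write a i v a' i' = if a' = a ∧ i' = i then v else s a' i' := by
  unfold Store.write
  by_cases ha : a' = a
  · subst ha
    by_cases hi : i' = i
    · subst hi; simp
    · simp [hi]
  · simp [ha]

theorem Store.write_of_ne (s : Store) {a a' : ℕ} (i v : ℕ) (h : a' ≠ a) :
    s.write a i v a' = s a' := by
  unfold Store.write
  simp [h]

theorem Store.Bounded.write {L : ℕ} {s : Store} (hs : s.Bounded L) {a i v : ℕ}
    (hv : v < 2 ^ L) : (s.write a i v).Bounded L := by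
  intro a' i'
  rw [Store.write_apply]
  split_ifs
  · exact Nat.size_le.mpr hv
  · exact hs a' i'

theorem Steps.bounded {L : ℕ} {c : Cmd} {s s' : Store} {k : ℕ} (h : Steps L c s k s')
    (hs : s.Bounded L) : s'.Bounded L := by
  induction h with
  | skip => exact hs
  | store a i e s h => exact hs.write h
  | seq _ _ ih₁ ih₂ => exact ih₂ (ih₁ hs)
  | cond_true _ _ ih => exact ih hs
  | cond_false _ _ ih => exact ih hs
  | loop_exit => exact hs
  | loop_step _ _ _ ih₁ ih₂ => exact ih₂ (ih₁ hs)

theorem size_op_le (o : Op) (x y : ℕ) : (o.eval x y).size ≤ x.size + y.size + 1 := by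
  have hx := Nat.lt_size_self x
  have hy := Nat.lt_size_self y
  have h1 : ∀ b : Prop, [Decidable b] → (if b then 1 else 0 : ℕ).size ≤ x.size + y.size + 1 := by
    intro b _
    split_ifs
    · simp
    · simp
  cases o with
  | add =>
    refine Nat.size_le.mpr ?_
    have h2 : 2 ^ x.size ≤ 2 ^ (x.size + y.size) := Nat.pow_le_pow_right (by norm_num) (by omega)
    have h3 : 2 ^ y.size ≤ 2 ^ (x.size + y.size) := Nat.pow_le_pow_right (by norm_num) (by omega)
    simp only [Op.eval, pow_succ]
    omega
  | sub => exact (Nat.size_le_size (Nat.sub_le x y)).trans (by omega)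
  | mul =>
    refine Nat.size_le.mpr ?_
    have h2 : x * y < 2 ^ x.size * 2 ^ y.size := Nat.mul_lt_mul'' hx hy
    rw [← pow_add] at h2
    simp only [Op.eval, pow_succ]
    omega
  | div => exact (Nat.size_le_size (Nat.div_le_self x y)).trans (by omega)
  | mod => exact (Nat.size_le_size (Nat.mod_le x y)).trans (by omega)
  | eq => exact h1 _
  | lt => exact h1 _

/-- An operation at most adds the bit lengths of its arguments, plus one. An expression being a
fixed tree, its intermediate values exceed the memory bound by a constant factor only, and `K`
depends on the tree alone. -/
theorem Expr.exists_cost_le (e : Expr) : ∃ K, ∀ L s, Store.Bounded L s →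
    e.cost s ≤ K * (L + 1) ^ 2 ∧ (e.eval s).size ≤ K * (L + 1) := by
  induction e with
  | lit k =>
    refine ⟨k.size + 1, fun L s _ => ⟨?_, ?_⟩⟩
    · exact Nat.le_mul_of_pos_right _ (by positivity)
    · exact (Nat.le_succ _).trans (Nat.le_mul_of_pos_right _ (by positivity))
  | load a i ih =>
    obtain ⟨K, hK⟩ := ih
    refine ⟨2 * K + 1, fun L s hs => ?_⟩
    obtain ⟨h1, h2⟩ := hK L s hs
    have h3 := hs a (i.eval s)
    have h4 : K * (L + 1) ≤ K * (L + 1) ^ 2 :=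
      Nat.mul_le_mul_left _ (Nat.le_self_pow (by norm_num) _)
    have h5 : L + 1 ≤ (L + 1) ^ 2 := Nat.le_self_pow (by norm_num) _
    simp only [Expr.cost, Expr.eval]
    constructor
    · linarith
    · nlinarith
  | binop o e₁ e₂ ih₁ ih₂ =>
    obtain ⟨K₁, hK₁⟩ := ih₁
    obtain ⟨K₂, hK₂⟩ := ih₂
    refine ⟨K₁ + K₂ + 1 + (K₁ + K₂ + 1) ^ 2, fun L s hs => ?_⟩
    obtain ⟨h1, h2⟩ := hK₁ L s hs
    obtain ⟨h3, h4⟩ := hK₂ L s hs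
    simp only [Expr.cost, Expr.eval]
    constructor
    · have h5 : (e₁.eval s).size + (e₂.eval s).size + 1 ≤ (K₁ + K₂ + 1) * (L + 1) := by nlinarith
      have h6 := Nat.pow_le_pow_left h5 2
      rw [mul_pow] at h6
      nlinarith [Nat.zero_le ((L + 1) ^ 2)]
    · have h5 := size_op_le o (e₁.eval s) (e₂.eval s)
      have h6 : 0 ≤ (K₁ + K₂ + 1) ^ 2 * (L + 1) := Nat.zero_le _
      nlinarith

/-- The bit cost is at most quadratic in the bit length of the numbers, for every step. -/
theorem Cmd.exists_cost_le (c : Cmd) : ∃ K, ∀ L s k s', Steps L c s k s' → Store.Bounded L s →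
    ∃ t ≤ k * (K * (L + 1) ^ 2), Exec c s t s' := by
  induction c with
  | skip =>
    refine ⟨1, fun L s k s' h _ => ?_⟩
    cases h
    exact ⟨1, by nlinarith [Nat.zero_le L], .skip s⟩
  | store a i e =>
    obtain ⟨K₁, hK₁⟩ := i.exists_cost_le
    obtain ⟨K₂, hK₂⟩ := e.exists_cost_le
    refine ⟨2 * K₁ + 2 * K₂ + 1, fun L s k s' h hs => ?_⟩
    cases h
    obtain ⟨h1, h2⟩ := hK₁ L s hs
    obtain ⟨h3, h4⟩ := hK₂ L s hs
    refine ⟨_, ?_, .store a i e s⟩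
    have h5 : K₁ * (L + 1) ≤ K₁ * (L + 1) ^ 2 :=
      Nat.mul_le_mul_left _ (Nat.le_self_pow (by norm_num) _)
    have h6 : K₂ * (L + 1) ≤ K₂ * (L + 1) ^ 2 :=
      Nat.mul_le_mul_left _ (Nat.le_self_pow (by norm_num) _)
    have h7 : 1 ≤ (L + 1) ^ 2 := Nat.one_le_pow _ _ (by omega)
    linarith
  | seq c₁ c₂ ih₁ ih₂ =>
    obtain ⟨K₁, hK₁⟩ := ih₁
    obtain ⟨K₂, hK₂⟩ := ih₂
    refine ⟨K₁ + K₂, fun L s k s' h hs => ?_⟩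
    cases h with
    | @seq _ _ _ _ _ k₁ k₂ h₁ h₂ =>
      obtain ⟨t₁, ht₁, hE₁⟩ := hK₁ _ _ _ _ h₁ hs
      obtain ⟨t₂, ht₂, hE₂⟩ := hK₂ _ _ _ _ h₂ (h₁.bounded hs)
      refine ⟨_, ?_, hE₁.seq hE₂⟩
      generalize (L + 1) ^ 2 = M at *
      nlinarith [Nat.zero_le (k₁ * (K₂ * M)), Nat.zero_le (k₂ * (K₁ * M))]
  | cond e c₁ c₂ ih₁ ih₂ =>
    obtain ⟨K₀, hK₀⟩ := e.exists_cost_le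
    obtain ⟨K₁, hK₁⟩ := ih₁
    obtain ⟨K₂, hK₂⟩ := ih₂
    refine ⟨K₀ + K₁ + K₂ + 1, fun L s k s' h hs => ?_⟩
    have h0 := (hK₀ L s hs).1
    have h7 : 1 ≤ (L + 1) ^ 2 := Nat.one_le_pow _ _ (by omega)
    cases h with
    | @cond_true _ _ _ _ _ k he h =>
      obtain ⟨t, ht, hE⟩ := hK₁ _ _ _ _ h hs
      refine ⟨_, ?_, .cond_true he hE⟩
      generalize (L + 1) ^ 2 = M at *
      have : 0 ≤ k * M := Nat.zero_le _
      nlinarith [Nat.zero_le (k * (K₀ * M)), Nat.zero_le (k * (K₂ * M)), Nat.zero_le (K₁ * M),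
        Nat.zero_le (K₂ * M)]
    | @cond_false _ _ _ _ _ k he h =>
      obtain ⟨t, ht, hE⟩ := hK₂ _ _ _ _ h hs
      refine ⟨_, ?_, .cond_false he hE⟩
      generalize (L + 1) ^ 2 = M at *
      have : 0 ≤ k * M := Nat.zero_le _
      nlinarith [Nat.zero_le (k * (K₀ * M)), Nat.zero_le (k * (K₁ * M)), Nat.zero_le (K₁ * M),
        Nat.zero_le (K₂ * M)]
  | loop e c ih =>
    obtain ⟨K₀, hK₀⟩ := e.exists_cost_le
    obtain ⟨K₁, hK₁⟩ := ih
    refine ⟨K₀ + K₁ + 1, fun L s k s' h hs => ?_⟩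
    -- Induction on the run, not on the syntax: one `K` serves all iterations, since the cap `2 ^ L`
    -- on written numbers keeps every intermediate memory bounded by the same `L`.
    generalize hd : Cmd.loop e c = d at h
    induction h with
    | skip => cases hd
    | store => cases hd
    | seq => cases hd
    | cond_true => cases hd
    | cond_false => cases hd
    | @loop_exit _ _ s he =>
      cases hd
      have h0 := (hK₀ L s hs).1
      have h7 : 1 ≤ (L + 1) ^ 2 := Nat.one_le_pow _ _ (by omega)
      refine ⟨_, ?_, he |> Exec.loop_stop⟩
      nlinarith [Nat.zero_le (K₁ * (L + 1) ^ 2)]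
    | @loop_step _ _ s s₁ s₂ k₁ k₂ he h₁ h₂ _ ih₂ =>
      cases hd
      have h0 := (hK₀ L s hs).1
      have h7 : 1 ≤ (L + 1) ^ 2 := Nat.one_le_pow _ _ (by omega)
      obtain ⟨t₁, ht₁, hE₁⟩ := hK₁ _ _ _ _ h₁ hs
      obtain ⟨t₂, ht₂, hE₂⟩ := ih₂ (h₁.bounded hs) rfl
      refine ⟨_, ?_, .loop_step he hE₁ hE₂⟩
      generalize (L + 1) ^ 2 = M at *
      nlinarith [Nat.zero_le (k₁ * (K₀ * M)), Nat.zero_le (K₁ * M), Nat.zero_le (k₁ * M)]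

/-! ## Total correctness with step bounds -/

/-- Started in `s`, the program `c` halts after at most `k` steps in a memory with property `Q`,
writing only numbers less than `2 ^ L`. -/
def Reaches (L : ℕ) (c : Cmd) (s : Store) (k : ℕ) (Q : Store → Prop) : Prop :=
  ∃ k' ≤ k, ∃ s', Steps L c s k' s' ∧ Q s'

variable {L : ℕ} {s : Store} {Q : Store → Prop}

theorem Reaches.mono {c : Cmd} {k k' : ℕ} {Q' : Store → Prop} (h : Reaches L c s k Q) (hk : k ≤ k')
    (hQ : ∀ s', Q s' → Q' s') : Reaches L c s k' Q' := by
  obtain ⟨j, hj, s', hs', hq⟩ := h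
  exact ⟨j, hj.trans hk, s', hs', hQ _ hq⟩

theorem Reaches.skip (h : Q s) : Reaches L .skip s 1 Q := ⟨1, le_rfl, s, .skip s, h⟩

theorem Reaches.store {a : ℕ} {i e : Expr} (h : e.eval s < 2 ^ L)
    (hQ : Q (s.write a (i.eval s) (e.eval s))) : Reaches L (.store a i e) s 1 Q :=
  ⟨1, le_rfl, _, .store a i e s h, hQ⟩

theorem Reaches.seq {c₁ c₂ : Cmd} {k₁ k₂ : ℕ} {R : Store → Prop} (h₁ : Reaches L c₁ s k₁ R)
    (h₂ : ∀ s', R s' → Reaches L c₂ s' k₂ Q) : Reaches L (.seq c₁ c₂) s (k₁ + k₂) Q := by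
  obtain ⟨j₁, hj₁, s₁, hs₁, hr⟩ := h₁
  obtain ⟨j₂, hj₂, s₂, hs₂, hq⟩ := h₂ _ hr
  exact ⟨_, add_le_add hj₁ hj₂, s₂, hs₁.seq hs₂, hq⟩

theorem Reaches.store_seq {a : ℕ} {i e : Expr} {c : Cmd} {k : ℕ} (h : e.eval s < 2 ^ L)
    (hQ : Reaches L c (s.write a (i.eval s) (e.eval s)) k Q) :
    Reaches L (.seq (.store a i e) c) s (k + 1) Q :=
  (Reaches.seq (R := fun s' => s' = s.write a (i.eval s) (e.eval s)) (Reaches.store h rfl)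
    (by rintro _ rfl; exact hQ)).mono (add_comm 1 k).le fun _ h => h

theorem Reaches.cond {e : Expr} {c₁ c₂ : Cmd} {k : ℕ} (h₁ : e.eval s ≠ 0 → Reaches L c₁ s k Q)
    (h₂ : e.eval s = 0 → Reaches L c₂ s k Q) : Reaches L (.cond e c₁ c₂) s (k + 1) Q := by
  by_cases he : e.eval s = 0
  · obtain ⟨j, hj, s', hs', hq⟩ := h₂ he
    exact ⟨_, Nat.succ_le_succ hj, s', .cond_false he hs', hq⟩
  · obtain ⟨j, hj, s', hs', hq⟩ := h₁ he
    exact ⟨_, Nat.succ_le_succ hj, s', .cond_true he hs', hq⟩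

/-- The rule for loops: the invariant `I` carries a bound on the number of iterations left. -/
theorem Reaches.loop {e : Expr} {c : Cmd} {k : ℕ} (I : ℕ → Store → Prop)
    (hstep : ∀ n s', I n s' → e.eval s' ≠ 0 →
      ∃ n', n = n' + 1 ∧ Reaches L c s' k (I n'))
    (hQ : ∀ n s', I n s' → e.eval s' = 0 → Q s') (N : ℕ) (h : I N s) :
    Reaches L (.loop e c) s (N * (k + 1) + 1) Q := by
  induction N using Nat.strong_induction_on generalizing s with
  | _ N ih =>
    by_cases he : e.eval s = 0
    · exact ⟨1, by omega, s, .loop_exit he, hQ _ _ h he⟩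
    · obtain ⟨n, rfl, j, hj, s₁, hs₁, hI⟩ := hstep _ _ h he
      obtain ⟨j₂, hj₂, s₂, hs₂, hq⟩ := ih n (by omega) hI
      refine ⟨_, ?_, s₂, .loop_step he hs₁ hs₂, hq⟩
      linarith

/-! ## Derived syntax -/

instance : Add Expr := ⟨.binop .add⟩
instance : Sub Expr := ⟨.binop .sub⟩
instance : Mul Expr := ⟨.binop .mul⟩
instance : Div Expr := ⟨.binop .div⟩
instance : Mod Expr := ⟨.binop .mod⟩

/-- Cell `0` of an array, used as a variable. -/
def Expr.var (a : ℕ) : Expr := .load a (.lit 0)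

/-- The test `e₁ < e₂`. -/
def Expr.less (e₁ e₂ : Expr) : Expr := .binop .lt e₁ e₂

/-- The assignment `a := e`. -/
def Cmd.assign (a : ℕ) (e : Expr) : Cmd := .store a (.lit 0) e

@[simp] theorem Expr.eval_add (e₁ e₂ : Expr) : (e₁ + e₂).eval s = e₁.eval s + e₂.eval s := rfl
@[simp] theorem Expr.eval_sub (e₁ e₂ : Expr) : (e₁ - e₂).eval s = e₁.eval s - e₂.eval s := rfl
@[simp] theorem Expr.eval_mul (e₁ e₂ : Expr) : (e₁ * e₂).eval s = e₁.eval s * e₂.eval s := rfl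
@[simp] theorem Expr.eval_div (e₁ e₂ : Expr) : (e₁ / e₂).eval s = e₁.eval s / e₂.eval s := rfl
@[simp] theorem Expr.eval_mod (e₁ e₂ : Expr) : (e₁ % e₂).eval s = e₁.eval s % e₂.eval s := rfl
@[simp] theorem Expr.eval_var (a : ℕ) : (Expr.var a).eval s = s a 0 := rfl
@[simp] theorem Expr.eval_lit (k : ℕ) : (Expr.lit k).eval s = k := rfl
@[simp] theorem Expr.eval_load (a : ℕ) (i : Expr) : (Expr.load a i).eval s = s a (i.eval s) := rfl
@[simp] theorem Expr.eval_less (e₁ e₂ : Expr) :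
    (e₁.less e₂).eval s = if e₁.eval s < e₂.eval s then 1 else 0 := rfl

theorem Reaches.assign {a : ℕ} {e : Expr} (h : e.eval s < 2 ^ L)
    (hQ : Q (s.write a 0 (e.eval s))) : Reaches L (.assign a e) s 1 Q :=
  Reaches.store h hQ

theorem Reaches.assign_seq {a : ℕ} {e : Expr} {c : Cmd} {k : ℕ} (h : e.eval s < 2 ^ L)
    (hQ : Reaches L c (s.write a 0 (e.eval s)) k Q) :
    Reaches L (.seq (.assign a e) c) s (k + 1) Q :=
  Reaches.store_seq h hQ

/-- `for x = 0, …, e - 1 do c`. -/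
def Cmd.forLoop (x : ℕ) (e : Expr) (c : Cmd) : Cmd :=
  .seq (.assign x (.lit 0)) (.loop (.less (.var x) e) (.seq c (.assign x (.var x + .lit 1))))

/-- The bound `e` is evaluated anew in each round, so the invariant must force its value to stay
`N`. The invariant is required after the increment of the counter, which the body must leave
unchanged. -/
theorem Reaches.forLoop {x : ℕ} {e : Expr} {c : Cmd} {k : ℕ} (I : ℕ → Store → Prop) (N : ℕ)
    (hN : N < 2 ^ L) (h0 : I 0 (s.write x 0 0))
    (he : ∀ i s', I i s' → e.eval s' = N)
    (hstep : ∀ i s', i < N → s' x 0 = i → I i s' →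
      Reaches L c s' k fun s'' => s'' x 0 = i ∧ I (i + 1) (s''.write x 0 (i + 1)))
    (hQ : ∀ s', I N s' → Q s') :
    Reaches L (.forLoop x e c) s (N * (k + 2) + 2) Q := by
  refine (Reaches.assign_seq (k := N * (k + 2) + 1) (by simp) ?_).mono (by omega) fun _ h => h
  refine (Reaches.loop (k := k + 1)
    (fun n s' => ∃ i, n + i = N ∧ s' x 0 = i ∧ I i s') ?_ ?_ N
    ⟨0, rfl, by simp [Store.write_apply], by simpa using h0⟩).mono le_rfl fun _ h => h
  · rintro n s' ⟨i, hi, hx, hI⟩ hlt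
    have hlt' : i < N := by
      by_contra hc
      simp [hx, he _ _ hI, hc] at hlt
    obtain ⟨n', rfl⟩ : ∃ n', n = n' + 1 := ⟨n - 1, by omega⟩
    refine ⟨n', rfl, ?_⟩
    refine Reaches.seq (hstep i s' hlt' hx hI) ?_
    rintro s'' ⟨hx', hI'⟩
    refine Reaches.assign (by simp [hx']; omega) ?_
    refine ⟨i + 1, by omega, by simp [Store.write_apply, hx'], by simpa [hx'] using hI'⟩
  · rintro n s' ⟨i, hi, hx, hI⟩ hlt
    have hge : ¬ i < N := by
      intro hc
      simp [hx, he _ _ hI, hc] at hlt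
    obtain rfl : i = N := by omega
    exact hQ _ hI

/-- `s'` differs from `s` at most in the arrays of `F`. -/
def Store.Agree (F : List ℕ) (s s' : Store) : Prop := ∀ a, a ∉ F → s' a = s a

theorem Store.Agree.refl (F : List ℕ) (s : Store) : s.Agree F s := fun _ _ => rfl

theorem Store.Agree.trans {F G : List ℕ} {s s' s'' : Store} (h : s.Agree F s')
    (h' : s'.Agree G s'') (hG : G ⊆ F) : s.Agree F s'' :=
  fun a ha => (h' a fun hg => ha (hG hg)).trans (h a ha)

theorem Store.Agree.write {F : List ℕ} {s s' : Store} (h : s.Agree F s') {a : ℕ} (i v : ℕ)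
    (ha : a ∈ F) : s.Agree F (s'.write a i v) := fun a' ha' => by
  rw [Store.write_of_ne _ _ _ (by rintro rfl; exact ha' ha)]
  exact h a' ha'

end RAM

namespace HPPK

open RAM RAM.Expr RAM.Cmd

/-! ## The program -/

/-- The value `2 (n + 1) m`, the number of entries of the public key. -/
def entries : Expr := .lit 2 * ((.load 0 (.lit 2) + .lit 1) * .load 0 (.lit 3))

/-- Search for a non-zero entry of the public key; variable `4` receives `j + 1`, where `j` is the
column of such an entry, and remains `0` if there is none. -/
def scan : Cmd :=
  forLoop 3 entries
    (.cond (.load 0 (.lit 4 + var 3)) (assign 4 (var 3 % .load 0 (.lit 3) + .lit 1)) .skip)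

/-- The inverse of `R_z` modulo `S`, in variable `7`, by the extended Euclidean algorithm. -/
def invert (z : ℕ) : Cmd :=
  .seq (assign 5 (.load 1 (.lit 1))) (.seq (assign 6 (.load 1 (.lit (2 + z))))
  (.seq (assign 7 (.lit 0)) (.seq (assign 8 (.lit 1))
  (.loop (var 6)
    (.seq (assign 9 ((var 7 + (.load 1 (.lit 1) - var 8) * (var 5 / var 6)) % .load 1 (.lit 1)))
    (.seq (assign 7 (var 8)) (.seq (assign 8 (var 9))
    (.seq (assign 9 (var 5 % var 6)) (.seq (assign 5 (var 6)) (assign 6 (var 9)))))))))))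

/-- Decryption of the chosen column of the matrix `P_z`. -/
def decrypt (z : ℕ) : Cmd :=
  forLoop 3 (.load 0 (.lit 2) + .lit 1)
    (.store (10 + z) (var 3)
      ((var 7 * .load 0 (.lit 3 + .lit z * ((.load 0 (.lit 2) + .lit 1) * .load 0 (.lit 3)) +
        var 3 * .load 0 (.lit 3) + var 4)) % .load 1 (.lit 1)))

/-- The number of coefficients that are handled. -/
def width (lam : ℕ) : Expr := .load 0 (.lit 2) + .lit (lam + 1)

/-- `α := c' α - c x ^ k β`, in the coefficient whose index stands in variable `3`, where the
variables `18` and `19` hold `c` and `c'`, and `k` is the difference of the lengths of the rows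
`x` and `y`. -/
def combine (x y α β : ℕ) : Cmd :=
  .store α (var 3)
    ((var 19 * .load α (var 3) + (.load 0 (.lit 1) - var 18) *
      ((.lit 1 - less (var 3) (var (16 + x) - var (16 + y))) *
        .load β (var 3 - (var (16 + x) - var (16 + y))))) % .load 0 (.lit 1))

/-- A step of the extended Euclidean algorithm for polynomials: if the formal leading coefficient
of row `y` is zero, its length decreases, otherwise the leading term of row `x` is eliminated. -/
def reduce (lam x y : ℕ) : Cmd :=
  .seq (assign 18 (.load (10 + x) (var (16 + x) - .lit 1)))
  (.seq (assign 19 (.load (10 + y) (var (16 + y) - .lit 1)))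
  (.cond (var 19)
    (.seq
      (forLoop 3 (width lam) (.seq (combine x y (10 + x) (10 + y))
        (.seq (combine x y (12 + x) (12 + y)) (combine x y (14 + x) (14 + y)))))
      (assign (16 + x) (var (16 + x) - .lit 1)))
    (assign (16 + y) (var (16 + y) - .lit 1))))

/-- The extended Euclidean algorithm for the polynomials in the arrays `10` and `11`. -/
def euclid (lam : ℕ) : Cmd :=
  .seq (.store 12 (.lit 0) (.lit 1)) (.seq (.store 15 (.lit 0) (.lit 1))
  (.seq (assign 16 (width lam)) (.seq (assign 17 (width lam))
  (.loop (var 16 * var 17)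
    (.cond (less (var 16) (var 17)) (reduce lam 1 0) (reduce lam 0 1))))))

/-- Output of the cofactors of row `r`. -/
def output (lam r : ℕ) : Cmd :=
  forLoop 3 (.lit (lam + 1))
    (.seq (.store 2 (.lit 4 + var 3) (.load (14 + r) (var 3)))
      (.store 2 (.lit (4 + (lam + 1)) + var 3)
        ((.load 0 (.lit 1) - .load (12 + r) (var 3)) % .load 0 (.lit 1))))

/-- Output of the length and the homomorphic key. -/
def header (lam : ℕ) : Cmd :=
  .seq (.store 2 (.lit 0) (.lit (3 + 2 * (lam + 1)))) (.seq (.store 2 (.lit 1) (.load 1 (.lit 1)))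
  (.seq (.store 2 (.lit 2) (.load 1 (.lit 2))) (.store 2 (.lit 3) (.load 1 (.lit 3)))))

/-- The program that computes a private key from a public key and a homomorphic key. -/
def program (lam : ℕ) : Cmd :=
  .seq (header lam) (.seq scan (.cond (var 4)
    (.seq (invert 0) (.seq (decrypt 0) (.seq (invert 1) (.seq (decrypt 1)
      (.seq (euclid lam) (.cond (var 17) (output lam 0) (output lam 1)))))))
    .skip))

/-! ## The parts of the program -/

variable {L : ℕ} {s : Store}

/-- The matrix entries start in cell `4`, after the length and `p, n, m`. Rows have length `m`, so
the column of entry `i` is `i % m`. -/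
theorem reaches_scan (h4 : s 4 0 = 0) {N : ℕ}
    (hN : 2 * ((s 0 2 + 1) * s 0 3) = N) (hL : N < 2 ^ L) :
    Reaches L scan s (N * 4 + 2) fun s' => s.Agree [3, 4] s' ∧
      ((s' 4 0 = 0 ∧ ∀ i < N, s 0 (4 + i) = 0) ∨
        ∃ i < N, s 0 (4 + i) ≠ 0 ∧ s' 4 0 = i % s 0 3 + 1) := by
  refine (Reaches.forLoop (k := 2) (fun k s' => s.Agree [3, 4] s' ∧
      ((s' 4 0 = 0 ∧ ∀ i < k, s 0 (4 + i) = 0) ∨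
        ∃ i < N, s 0 (4 + i) ≠ 0 ∧ s' 4 0 = i % s 0 3 + 1)) N hL ?_ ?_ ?_ ?_)
  · exact ⟨(Store.Agree.refl _ _).write _ _ (by simp), Or.inl
      ⟨by simp [Store.write_apply, h4], by simp⟩⟩
  · rintro i s' ⟨hA, -⟩
    simp [entries, hA 0, hN]
  · rintro i s' hi h3 ⟨hA, hI⟩
    refine Reaches.cond (k := 1) (fun he => ?_) (fun he => ?_)
    · simp [hA 0, h3] at he
      have h5 := Nat.mod_le i (s 0 3)
      refine Reaches.assign (by simp [hA 0, h3]; omega) ⟨by simp [Store.write_apply, h3],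
        (hA.write _ _ (by simp)).write _ _ (by simp), Or.inr ⟨i, hi, he, ?_⟩⟩
      simp [Store.write_apply, h3, hA 0]
    · simp [hA 0, h3] at he
      refine Reaches.skip ⟨h3, hA.write _ _ (by simp), ?_⟩
      simp only [Store.write_apply]
      simp only [show (4:ℕ) ≠ 3 by norm_num, false_and, if_false]
      rcases hI with ⟨h, hI⟩ | hI
      · refine Or.inl ⟨h, fun j hj => ?_⟩
        rcases Nat.lt_succ_iff_lt_or_eq.mp hj with hj | rfl
        · exact hI j hj
        · exact he
      · exact Or.inr hI
  · exact fun s' h => h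

/-- Consecutive remainders `a > b` carry multipliers with `x R ≡ a` and `y R ≡ b` modulo `S`, where
`S - y` replaces `-y`. The variant is an exponent `n` with `a * b < 2 ^ n`; at the start `S * R < 2
^ (2 * L)`. -/
theorem reaches_invert {z : ℕ} {S R : ℕ} (hS : s 1 1 = S) (hR : s 1 (2 + z) = R) (hlt : R < S)
    (hco : R.Coprime S) (hL : S < 2 ^ L) :
    Reaches L (invert z) s (2 * L * 7 + 5) fun s' =>
      s.Agree [5, 6, 7, 8, 9] s' ∧ s' 7 0 * R ≡ 1 [MOD S] := by
  have h1 : 1 < 2 ^ L ∨ S = 1 := by omega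
  have h1' : 1 < 2 ^ L := by
    rcases h1 with h | h <;> omega
  refine (Reaches.assign_seq (k := 2 * L * 7 + 4) (by simpa [hS] using hL) ?_).mono (by omega)
    fun _ h => h
  refine (Reaches.assign_seq (k := 2 * L * 7 + 3)
    (by simp [Store.write_apply, hR]; omega) ?_).mono (by omega) fun _ h => h
  refine (Reaches.assign_seq (k := 2 * L * 7 + 2) (by simp) ?_).mono (by omega) fun _ h => h
  refine (Reaches.assign_seq (k := 2 * L * 7 + 1) (by simpa using h1') ?_).mono (by omega)
    fun _ h => h
  refine Reaches.loop (k := 6) (fun n s' => s.Agree [5, 6, 7, 8, 9] s' ∧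
    ∃ a b x y, s' 5 0 = a ∧ s' 6 0 = b ∧ s' 7 0 = x ∧ s' 8 0 = y ∧ b < a ∧ a ≤ S ∧ a.Coprime b ∧
      x * R ≡ a [MOD S] ∧ y * R ≡ b [MOD S] ∧ x ≤ S ∧ y ≤ S ∧ a * b < 2 ^ n) ?_ ?_ (2 * L) ?_
  · rintro n s' ⟨hA, a, b, x, y, ha, hb, hx, hy, hba, haS, hab, hxa, hyb, hxS, hyS, hn⟩ h0
    have hb0 : 0 < b := by simp [hb] at h0; omega
    have hmod := Nat.mod_lt a hb0
    have hdiv := Nat.div_add_mod a b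
    have hq : 1 ≤ a / b := (Nat.one_le_div_iff hb0).mpr hba.le
    obtain ⟨n', rfl⟩ : ∃ n', n = n' + 1 := by
      refine ⟨n - 1, ?_⟩
      rcases n with _ | n
      · have : 0 < a * b := Nat.mul_pos (by omega) hb0
        omega
      · rfl
    refine ⟨n', rfl, ?_⟩
    have hSpos : 0 < S := by omega
    have hmS : ∀ v, v % S < S := fun v => Nat.mod_lt v hSpos
    refine (Reaches.assign_seq (k := 5) ?_ (Reaches.assign_seq (k := 4) ?_ (Reaches.assign_seq
      (k := 3) ?_ (Reaches.assign_seq (k := 2) ?_ (Reaches.assign_seq (k := 1) ?_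
      (Reaches.assign ?_ ?_))))))
    · simp [hA 1, hS]; exact (hmS _).trans hL
    · simp [Store.write_apply, hy]; omega
    · simp [Store.write_apply, hA 1, hS]; exact (hmS _).trans hL
    · simp [Store.write_apply, ha, hb]; omega
    · simp [Store.write_apply, hb]; omega
    · simp [Store.write_apply, ha, hb]; omega
    · refine ⟨by repeat' first | exact hA | refine Store.Agree.write ?_ _ _ (by simp),
        b, a % b, y, (x + (S - y) * (a / b)) % S, by simp [Store.write_apply, hb],
        by simp [Store.write_apply, ha, hb], by simp [Store.write_apply, hy],
        by simp [Store.write_apply, ha, hb, hx, hy, hA 1, hS], hmod, by omega, ?_, hyb, ?_, hyS,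
        (hmS _).le, ?_⟩
      · rw [Nat.coprime_comm, Nat.Coprime, ← Nat.gcd_rec, Nat.gcd_comm]
        exact hab
      · refine ((Nat.mod_modEq _ _).mul_right R).trans ?_
        rw [← ZMod.natCast_eq_natCast_iff] at hxa hyb ⊢
        have hd : (b : ZMod S) * (a / b : ℕ) + (a % b : ℕ) = a := by
          exact_mod_cast congrArg (Nat.cast (R := ZMod S)) hdiv
        push_cast [Nat.cast_sub hyS] at *
        rw [ZMod.natCast_self]
        linear_combination hxa - (a / b : ℕ) * hyb - hd
      · rw [pow_succ] at hn
        -- The quotient is at least `1`, so `a ≥ b + a % b > 2 * (a % b)`; the product of the two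
        -- remainders is more than halved.
        have h5 : 2 * (a % b) < a := by nlinarith
        have h6 := Nat.mul_lt_mul_of_pos_right h5 hb0
        nlinarith
  · rintro n s' ⟨hA, a, b, x, y, ha, hb, hx, hy, hba, haS, hab, hxa, hyb, hxS, hyS, hn⟩ h0
    simp [hb] at h0
    subst h0
    rw [Nat.coprime_zero_right] at hab
    subst hab
    exact ⟨hA, by rw [hx]; exact hxa⟩
  · refine ⟨by repeat' first | exact .refl _ _ | refine Store.Agree.write ?_ _ _ (by simp),
      S, R, 0, 1, by simp [Store.write_apply, hS], by simp [Store.write_apply, hR],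
      by simp [Store.write_apply], by simp [Store.write_apply], hlt, le_rfl, hco.symm, ?_, ?_,
      by omega, by omega, ?_⟩
    · rw [zero_mul]; exact (Nat.modEq_zero_iff_dvd.mpr dvd_rfl).symm
    · rw [one_mul]
    · rw [mul_comm 2 L, pow_mul]
      nlinarith

/-- The base address is `3` rather than `4` because variable `4` holds the column plus one. Cells
beyond `n` are left alone, so their zeros later serve as padding. -/
theorem reaches_decrypt {z : ℕ} (hz : z < 2) (hS : 0 < s 1 1) (hL : s 1 1 < 2 ^ L)
    (hnL : s 0 2 + 1 < 2 ^ L) :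
    Reaches L (decrypt z) s ((s 0 2 + 1) * 3 + 2) fun s' =>
      s.Agree [3, 10 + z] s' ∧
      (∀ i ≤ s 0 2, s' (10 + z) i =
        s 7 0 * s 0 (3 + z * ((s 0 2 + 1) * s 0 3) + i * s 0 3 + s 4 0) % s 1 1) ∧
      ∀ i, s 0 2 < i → s' (10 + z) i = s (10 + z) i := by
  have hz3 : 3 ≠ 10 + z := by omega
  refine (Reaches.forLoop (k := 1) (fun k s' => s.Agree [3, 10 + z] s' ∧
      (∀ i < k, s' (10 + z) i =
        s 7 0 * s 0 (3 + z * ((s 0 2 + 1) * s 0 3) + i * s 0 3 + s 4 0) % s 1 1) ∧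
      ∀ i, k ≤ i → s' (10 + z) i = s (10 + z) i) (s 0 2 + 1) hnL ?_ ?_ ?_ ?_)
  · refine ⟨(Store.Agree.refl _ _).write _ _ (by simp), by simp, fun i _ => ?_⟩
    simp [Store.write_apply, hz3.symm]
  · rintro i s' ⟨hA, -⟩
    simp [hA 0 (by simp; omega)]
  · rintro i s' hi h3 ⟨hA, hI, hI'⟩
    have h0 := hA 0 (by simp; omega)
    have h1 := hA 1 (by simp; omega)
    have h4 := hA 4 (by simp; omega)
    have h7 := hA 7 (by simp; omega)
    refine Reaches.store ?_ ⟨?_, ?_, ?_, ?_⟩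
    · simp only [eval_mod, eval_load, eval_lit, h1]
      exact (Nat.mod_lt _ hS).trans hL
    · simp [Store.write_apply, hz3, h3]
    · exact (hA.write _ _ (by simp)).write _ _ (by simp)
    · intro j hj
      simp only [Store.write_apply]
      simp only [hz3.symm, false_and, if_false, true_and, eval_var, h3]
      rcases Nat.lt_succ_iff_lt_or_eq.mp hj with hj | rfl
      · rw [if_neg (by omega), hI j hj]
      · simp [h0, h1, h4, h7, h3]
    · intro j hj
      simp only [Store.write_apply]
      simp only [hz3.symm, false_and, if_false, true_and, eval_var, h3]
      rw [if_neg (by omega), hI' j (by omega)]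
  · rintro s' ⟨hA, hI, hI'⟩
    exact ⟨hA, fun i hi => hI i (by omega), fun i hi => hI' i hi⟩

end HPPK

namespace HPPK

open RAM RAM.Expr RAM.Cmd

variable {L : ℕ} {s : Store}

/-! ## The Euclidean algorithm for polynomials -/

/-- Since `c.val < p`, the truncated difference `p - c.val` is a true one and represents `-c`. -/
theorem combine_val {p : ℕ} [NeZero p] (a b c d : ZMod p) :
    (a.val * b.val + (p - c.val) * d.val) % p = (a * b - c * d).val := by
  rw [← ZMod.val_natCast]
  congr 1
  push_cast [Nat.cast_sub (ZMod.val_lt c).le]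
  simp only [ZMod.natCast_val, ZMod.cast_id', id_eq, CharP.cast_eq_zero]
  ring

/-- For `i < k` the truncated index `i - k` reads cell `0`; the factor `1 - less` cancels that
value, as multiplication by `X ^ k` demands. -/
theorem eval_combine {p : ℕ} [NeZero p] {x y α β i k : ℕ} {c d : ZMod p} {F G : (ZMod p)[X]}
    {e : ℕ} (he : s α i = e)
    (hp : s 0 1 = p) (h3 : s 3 0 = i) (h18 : s 18 0 = c.val) (h19 : s 19 0 = d.val)
    (hk : s (16 + x) 0 - s (16 + y) 0 = k) (hF : e = (F.coeff i).val)
    (hG : s β (i - k) = (G.coeff (i - k)).val) :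
    (((var 19 * .load α (var 3) + (.load 0 (.lit 1) - var 18) *
      ((.lit 1 - less (var 3) (var (16 + x) - var (16 + y))) *
        .load β (var 3 - (var (16 + x) - var (16 + y))))) % .load 0 (.lit 1) : Expr)).eval s =
      ((C d * F - C c * (X ^ k * G)).coeff i).val := by
  simp only [eval_mod, eval_add, eval_mul, eval_sub, eval_var, eval_load, eval_lit, eval_less, hp,
    h3, h18, h19, hk, he, hF, hG, coeff_sub, coeff_C_mul, coeff_X_pow_mul']
  rw [← combine_val]
  by_cases h : i < k
  · simp [h, not_le.mpr h]
  · simp [h, not_lt.mp h]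

/-- Row `x` of the extended Euclidean algorithm represents the polynomials `F 0`, `F 1`, `F 2`,
where `F 0 = F 1 * u + F 2 * v`. -/
structure Row {p : ℕ} (W : ℕ) (u v : (ZMod p)[X]) (s : Store) (x : ℕ) (F : ℕ → (ZMod p)[X]) :
    Prop where
  rep : ∀ c < 3, ∀ i < W, s (10 + 2 * c + x) i = ((F c).coeff i).val
  length_le : s (16 + x) 0 ≤ W
  coeff_eq_zero : ∀ i, s (16 + x) 0 ≤ i → (F 0).coeff i = 0
  relation : F 0 = F 1 * u + F 2 * v

theorem Row.congr {p W : ℕ} {u v : (ZMod p)[X]} {s s' : Store} {x : ℕ} {F : ℕ → (ZMod p)[X]}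
    (h : Row W u v s x F) (h' : ∀ c < 4, s' (10 + 2 * c + x) = s (10 + 2 * c + x)) :
    Row W u v s' x F := by
  -- The case `c = 3` is the array `16 + x` with the length of the row.
  have h16 := h' 3 (by norm_num)
  norm_num at h16
  refine ⟨fun c hc i hi => ?_, ?_, ?_, h.relation⟩
  · rw [h' c (by omega)]; exact h.rep c hc i hi
  · rw [h16]; exact h.length_le
  · rw [h16]; exact h.coeff_eq_zero

/-- Updating in place is safe: the new coefficient `i` depends on the old coefficient `i` of row `x`
and on row `y`, which does not change. Only indices at most `i` are read, so cutting off at `W`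
loses nothing below `W`. -/
theorem reaches_eliminate {lam p W x y : ℕ} [NeZero p] (hxy : x = 0 ∧ y = 1 ∨ x = 1 ∧ y = 0)
    {c d : ZMod p} {F G : ℕ → (ZMod p)[X]}
    (hp : s 0 1 = p) (hW : s 0 2 + (lam + 1) = W) (hpL : p < 2 ^ L) (hWL : W < 2 ^ L)
    (h18 : s 18 0 = c.val) (h19 : s 19 0 = d.val)
    (hF : ∀ c < 3, ∀ i < W, s (10 + 2 * c + x) i = ((F c).coeff i).val)
    (hG : ∀ c < 3, ∀ i < W, s (10 + 2 * c + y) i = ((G c).coeff i).val) :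
    Reaches L (forLoop 3 (width lam) (.seq (combine x y (10 + x) (10 + y))
        (.seq (combine x y (12 + x) (12 + y)) (combine x y (14 + x) (14 + y))))) s
      (W * 5 + 2) fun s' => s.Agree [3, 10 + x, 12 + x, 14 + x] s' ∧
        ∀ r < 3, ∀ i < W, s' (10 + 2 * r + x) i =
          ((C d * F r - C c * (X ^ (s (16 + x) 0 - s (16 + y) 0) * G r)).coeff i).val := by
  set k := s (16 + x) 0 - s (16 + y) 0 with hk
  refine (Reaches.forLoop (k := 3) (fun j s' => s.Agree [3, 10 + x, 12 + x, 14 + x] s' ∧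
        ∀ r < 3, ∀ i < W, s' (10 + 2 * r + x) i =
          if i < j then ((C d * F r - C c * (X ^ k * G r)).coeff i).val
          else s (10 + 2 * r + x) i) W hWL ?_ ?_ ?_ ?_)
  · refine ⟨(Store.Agree.refl _ _).write _ _ (by simp), fun r hr i hi => ?_⟩
    rw [Store.write_of_ne _ _ _ (by omega)]
    simp
  · rintro i s' ⟨hA, -⟩
    have := hA 0 (by simp; omega)
    simp [width, this, hW]
  · rintro i s' hi h3 ⟨hA, hI⟩
    have h0 := hA 0 (by simp; omega)
    have hx : s' (16 + x) = s (16 + x) := hA _ (by simp; omega)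
    have hy : s' (16 + y) = s (16 + y) := hA _ (by simp; omega)
    have h18' := hA 18 (by simp; omega)
    have h19' := hA 19 (by simp; omega)
    have hG' : ∀ r < 3, s' (10 + 2 * r + y) (i - k) = ((G r).coeff (i - k)).val := by
      intro r hr
      rw [hA _ (by simp; omega)]
      exact hG r hr _ (by omega)
    have hF' : ∀ r < 3, s' (10 + 2 * r + x) i = s (10 + 2 * r + x) i := by
      intro r hr
      rw [hI r hr i hi, if_neg (lt_irrefl i)]
    have hlt : ∀ v : ZMod p, v.val < 2 ^ L := fun v => (ZMod.val_lt v).trans hpL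
    have e0 := eval_combine (s := s') (x := x) (y := y) (α := 10 + x) (β := 10 + y)
      (hF' 0 (by norm_num)) (by rw [h0, hp]) h3 (by rw [h18', h18]) (by rw [h19', h19])
      (by rw [hx, hy]) (hF 0 (by norm_num) i hi) (hG' 0 (by norm_num))
    set s₁ := s'.write (10 + x) i ((C d * F 0 - C c * (X ^ k * G 0)).coeff i).val with hs₁
    have a₁ : ∀ a, a ≠ 10 + x → s₁ a = s' a := fun a ha => Store.write_of_ne _ _ _ ha
    have e1 := eval_combine (s := s₁) (x := x) (y := y) (α := 12 + x) (β := 12 + y)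
      (by rw [a₁ _ (by omega)]; exact hF' 1 (by norm_num)) (by rw [a₁ _ (by omega), h0, hp])
      (by rw [a₁ _ (by omega)]; exact h3)
      (by rw [a₁ _ (by omega), h18', h18]) (by rw [a₁ _ (by omega), h19', h19])
      (by rw [a₁ _ (by omega), a₁ _ (by omega), hx, hy]) (hF 1 (by norm_num) i hi)
      (by rw [a₁ _ (by omega)]; exact hG' 1 (by norm_num))
    set s₂ := s₁.write (12 + x) i ((C d * F 1 - C c * (X ^ k * G 1)).coeff i).val with hs₂
    have a₂ : ∀ a, a ≠ 10 + x → a ≠ 12 + x → s₂ a = s' a := fun a ha ha' =>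
      (Store.write_of_ne _ _ _ ha').trans (a₁ a ha)
    have e2 := eval_combine (s := s₂) (x := x) (y := y) (α := 14 + x) (β := 14 + y)
      (by rw [a₂ _ (by omega) (by omega)]; exact hF' 2 (by norm_num))
      (by rw [a₂ _ (by omega) (by omega), h0, hp])
      (by rw [a₂ _ (by omega) (by omega)]; exact h3)
      (by rw [a₂ _ (by omega) (by omega), h18', h18])
      (by rw [a₂ _ (by omega) (by omega), h19', h19])
      (by rw [a₂ _ (by omega) (by omega), a₂ _ (by omega) (by omega), hx, hy])
      (hF 2 (by norm_num) i hi)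
      (by rw [a₂ _ (by omega) (by omega)]; exact hG' 2 (by norm_num))
    have i1 : (var 3).eval s₁ = i := by rw [eval_var, a₁ _ (by omega), h3]
    have i2 : (var 3).eval s₂ = i := by rw [eval_var, a₂ _ (by omega) (by omega), h3]
    refine Reaches.store_seq (k := 2) (by rw [e0]; exact hlt _) ?_
    rw [e0, eval_var, h3, ← hs₁]
    refine Reaches.store_seq (k := 1) (by rw [e1]; exact hlt _) ?_
    rw [e1, i1, ← hs₂]
    refine Reaches.store (by rw [e2]; exact hlt _) ?_
    rw [e2, i2]
    refine ⟨?_, ?_, fun r hr j hj => ?_⟩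
    · rw [Store.write_of_ne _ _ _ (by omega), a₂ _ (by omega) (by omega), h3]
    · exact (((hA.write _ _ (by simp)).write _ _ (by simp)).write _ _ (by simp)).write _ _ (by simp)
    · have hI' := hI r hr j hj
      rw [Store.write_of_ne _ _ _ (by omega), hs₂, hs₁]
      simp only [Store.write_apply]
      by_cases hji : j = i
      · subst hji
        interval_cases r <;> simp [← hk]
      · simp only [hji, and_false, if_false, hI']
        have : j < i + 1 ↔ j < i := by omega
        simp only [this]
  · rintro s' ⟨hA, hI⟩
    refine ⟨hA, fun r hr i hi => ?_⟩
    rw [hI r hr i hi, if_pos hi]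

/-- Lengths only bound the degrees, so a formal leading coefficient may vanish. If that of `y` does,
row `y` is shortened for free; otherwise the combination `d F - c X ^ k G` kills the top term of `x`
without any division in the field. -/
theorem reaches_reduce {lam p W x y : ℕ} [Fact p.Prime] (hxy : x = 0 ∧ y = 1 ∨ x = 1 ∧ y = 0)
    {u v : (ZMod p)[X]} {F G : ℕ → (ZMod p)[X]}
    (hp : s 0 1 = p) (hW : s 0 2 + (lam + 1) = W) (hpL : p < 2 ^ L) (hWL : W < 2 ^ L)
    (hF : Row W u v s x F) (hG : Row W u v s y G) (hle : s (16 + y) 0 ≤ s (16 + x) 0)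
    (hpos : 0 < s (16 + y) 0) (hdet : ∃ e : ZMod p, e ≠ 0 ∧ F 1 * G 2 - F 2 * G 1 = C e) :
    Reaches L (reduce lam x y) s (W * 5 + 6) fun s' => (∀ a < 3, s' a = s a) ∧
      (∃ F' G', Row W u v s' x F' ∧ Row W u v s' y G' ∧
        ∃ e : ZMod p, e ≠ 0 ∧ F' 1 * G' 2 - F' 2 * G' 1 = C e) ∧
      s' (16 + x) 0 + s' (16 + y) 0 + 1 = s (16 + x) 0 + s (16 + y) 0 := by
  obtain ⟨e, he, hdet⟩ := hdet
  have hxW := hF.length_le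
  have hyW := hG.length_le
  have hlt : ∀ v : ZMod p, v.val < 2 ^ L := fun v => (ZMod.val_lt v).trans hpL
  have ex := hF.rep 0 (by norm_num) (s (16 + x) 0 - 1) (by omega)
  have ey := hG.rep 0 (by norm_num) (s (16 + y) 0 - 1) (by omega)
  set c := (F 0).coeff (s (16 + x) 0 - 1) with hc
  set d := (G 0).coeff (s (16 + y) 0 - 1) with hd
  norm_num at ex ey
  refine (Reaches.assign_seq (k := W * 5 + 5) (by simp [ex, hlt]) (Reaches.assign_seq
    (k := W * 5 + 4) ?_ ?_)).mono (by omega) fun _ h => h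
  · rw [eval_load, Store.write_of_ne _ _ _ (by omega), eval_sub, eval_var,
      Store.write_of_ne _ _ _ (by omega), eval_lit, ey]
    exact hlt _
  rw [eval_load, eval_sub, eval_var, eval_lit, ex, eval_load,
    Store.write_of_ne _ _ _ (by omega), eval_sub, eval_var,
      Store.write_of_ne _ _ _ (by omega), eval_lit, ey]
  set s₁ := (s.write 18 0 c.val).write 19 0 d.val with hs₁
  have a₁ : ∀ a, a ≠ 18 → a ≠ 19 → s₁ a = s a := fun a h h' =>
    (Store.write_of_ne _ _ _ h').trans (Store.write_of_ne _ _ _ h)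
  have h18 : s₁ 18 0 = c.val := by simp [hs₁, Store.write_apply]
  have h19 : s₁ 19 0 = d.val := by simp [hs₁, Store.write_apply]
  refine (Reaches.cond (k := W * 5 + 3) (fun h0 => ?_) fun h0 => ?_)
  · rw [eval_var, h19, Ne, ZMod.val_eq_zero] at h0
    refine Reaches.seq (k₁ := W * 5 + 2) (k₂ := 1) (reaches_eliminate hxy (c := c) (d := d)
      (F := F) (G := G)
      (by rw [a₁ _ (by omega) (by omega), hp])
      (by rw [a₁ _ (by omega) (by omega), hW]) hpL hWL h18 h19 ?_ ?_) ?_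
    · intro r hr i hi
      rw [a₁ _ (by omega) (by omega)]; exact hF.rep r hr i hi
    · intro r hr i hi
      rw [a₁ _ (by omega) (by omega)]; exact hG.rep r hr i hi
    rintro s' ⟨hA, hr⟩
    have a₂ : ∀ a, a ≠ 3 → a ≠ 10 + x → a ≠ 12 + x → a ≠ 14 + x → a ≠ 18 → a ≠ 19 →
        s' a = s a := fun a h h' h'' h''' i i' => (hA a (by simp; omega)).trans (a₁ a i i')
    have hx : s' (16 + x) = s (16 + x) := a₂ _ (by omega) (by omega) (by omega) (by omega)
      (by omega) (by omega)
    refine Reaches.assign (by simp [hx]; omega) ?_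
    rw [Expr.eval_sub, eval_var, eval_lit, hx]
    rw [a₁ _ (by omega) (by omega), a₁ _ (by omega) (by omega)] at hr
    set k := s (16 + x) 0 - s (16 + y) 0 with hk
    have hxx : s'.write (16 + x) 0 (s (16 + x) 0 - 1) (16 + x) 0 = s (16 + x) 0 - 1 := by
      simp [Store.write_apply]
    refine ⟨fun a ha => ?_, ⟨fun r => C d * F r - C c * (X ^ k * G r), G,
      ⟨fun r hr' i hi => ?_, ?_, ?_, ?_⟩, ?_, ?_⟩, ?_⟩
    · rw [Store.write_of_ne _ _ _ (by omega), a₂ a] <;> omega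
    · rw [Store.write_of_ne _ _ _ (by omega)]; exact hr r hr' i hi
    · rw [hxx]; omega
    · rw [hxx]
      intro i hi
      rw [coeff_sub, coeff_C_mul, coeff_C_mul, coeff_X_pow_mul', if_pos (by omega)]
      rcases Nat.lt_or_ge i (s (16 + x) 0) with h | h
      · obtain rfl : i = s (16 + x) 0 - 1 := by omega
        -- The shift by `k` aligns both top coefficients, which leaves `d c - c d = 0`.
        rw [show s (16 + x) 0 - 1 - k = s (16 + y) 0 - 1 by omega, ← hc, ← hd]
        ring
      · rw [hF.coeff_eq_zero i h, hG.coeff_eq_zero (i - k) (by omega)]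
        ring
    · simp only [hF.relation, hG.relation]
      ring
    · refine hG.congr fun r hr' => ?_
      rw [Store.write_of_ne _ _ _ (by omega), a₂] <;> omega
    -- Scaling row `x` by `d` scales the determinant by `d`; subtracting a multiple of row `y` does
    -- not change it.
    · refine ⟨d * e, mul_ne_zero h0 he, ?_⟩
      rw [C_mul, ← hdet]
      ring
    · rw [hxx, Store.write_of_ne _ _ _ (by omega), a₂] <;> omega
  · rw [eval_var, h19, ZMod.val_eq_zero] at h0
    have hy : s₁ (16 + y) = s (16 + y) := a₁ _ (by omega) (by omega)
    refine (Reaches.assign (by simp [hy]; omega) ?_).mono (by omega) fun _ h => h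
    rw [Expr.eval_sub, eval_var, eval_lit, hy]
    have hyy : s₁.write (16 + y) 0 (s (16 + y) 0 - 1) (16 + y) 0 = s (16 + y) 0 - 1 := by
      simp [Store.write_apply]
    refine ⟨fun a ha => ?_, ⟨F, G, ?_, ⟨fun r hr' i hi => ?_, ?_, ?_, hG.relation⟩, e, he, hdet⟩,
      ?_⟩
    · rw [Store.write_of_ne _ _ _ (by omega), a₁ a] <;> omega
    · refine hF.congr fun r hr' => ?_
      rw [Store.write_of_ne _ _ _ (by omega), a₁] <;> omega
    · rw [Store.write_of_ne _ _ _ (by omega), a₁ _ (by omega) (by omega)]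
      exact hG.rep r hr' i hi
    · rw [hyy]; omega
    · rw [hyy]
      intro i hi
      rcases Nat.lt_or_ge i (s (16 + y) 0) with h | h
      · obtain rfl : i = s (16 + y) 0 - 1 := by omega
        exact h0
      · exact hG.coeff_eq_zero i h
    · rw [hyy, Store.write_of_ne _ _ _ (by omega), a₁] <;> omega

/-- The memory after the Euclidean algorithm. -/
def Reduced {p : ℕ} (W : ℕ) (u v : (ZMod p)[X]) (s s' : Store) : Prop :=
  (∀ a < 3, s' a = s a) ∧ ∃ F G, Row W u v s' 0 F ∧ Row W u v s' 1 G ∧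
    ∃ e : ZMod p, e ≠ 0 ∧ F 1 * G 2 - F 2 * G 1 = C e

theorem reaches_euclid {lam p W : ℕ} [Fact p.Prime] {u v : (ZMod p)[X]}
    (hp : s 0 1 = p) (hW : s 0 2 + (lam + 1) = W) (hpL : p < 2 ^ L) (hWL : W < 2 ^ L)
    (hu : ∀ i < W, s 10 i = (u.coeff i).val) (hv : ∀ i < W, s 11 i = (v.coeff i).val)
    (hu' : ∀ i, W ≤ i → u.coeff i = 0) (hv' : ∀ i, W ≤ i → v.coeff i = 0)
    (h0 : ∀ a, 12 ≤ a → a ≤ 15 → ∀ i, s a i = 0) :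
    Reaches L (euclid lam) s (2 * W * (W * 5 + 8) + 5) fun s' =>
      Reduced W u v s s' ∧ s' 16 0 * s' 17 0 = 0 := by
  have hp1 : 1 < p := (Fact.out : p.Prime).one_lt
  have h1L : 1 < 2 ^ L := by omega
  have : Fact (1 < p) := ⟨hp1⟩
  refine Reaches.store_seq (k := 2 * W * (W * 5 + 8) + 4) ?_ (Reaches.store_seq
    (k := 2 * W * (W * 5 + 8) + 3) ?_ (Reaches.assign_seq (k := 2 * W * (W * 5 + 8) + 2) ?_
    (Reaches.assign_seq (k := 2 * W * (W * 5 + 8) + 1) ?_ (Reaches.loop (k := W * 5 + 7)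
      (fun n s' => Reduced W u v s s' ∧ s' 16 0 + s' 17 0 = n) ?_ ?_ (2 * W) ?_))))
  · exact h1L
  · exact h1L
  · simp [width, Store.write_apply, hW, hWL]
  · simp [width, Store.write_apply, hW, hWL]
  · rintro n s' ⟨⟨hA, F, G, hF, hG, hdet⟩, hn⟩ hne
    have hne' : s' 16 0 ≠ 0 ∧ s' 17 0 ≠ 0 := by simpa using hne
    refine ⟨n - 1, by omega, Reaches.cond (k := W * 5 + 6) (fun h => ?_) fun h => ?_⟩
    · have hlt : s' 16 0 < s' 17 0 := by
        by_contra hc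
        simp [hc] at h
      refine (reaches_reduce (by omega) (by rw [hA 0 (by omega), hp]) (by rw [hA 0 (by omega), hW])
        hpL hWL hG hF hlt.le (Nat.pos_of_ne_zero hne'.1) ?_).mono le_rfl ?_
      -- Here the rows exchange their roles, so the determinant changes sign on entry and again on
      -- return.
      · obtain ⟨e, he, hdet⟩ := hdet
        exact ⟨-e, neg_ne_zero.mpr he, by rw [C_neg, ← hdet]; ring⟩
      · rintro s'' ⟨hA', ⟨F', G', hF', hG', e, he, hdet⟩, hsum⟩
        refine ⟨⟨fun a ha => (hA' a ha).trans (hA a ha), G', F', hG', hF', -e, neg_ne_zero.mpr he,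
          by rw [C_neg, ← hdet]; ring⟩, ?_⟩
        norm_num at hsum
        omega
    · have hlt : s' 17 0 ≤ s' 16 0 := by
        by_contra hc
        simp [not_le.mp hc] at h
      refine (reaches_reduce (by omega) (by rw [hA 0 (by omega), hp]) (by rw [hA 0 (by omega), hW])
        hpL hWL hF hG hlt (Nat.pos_of_ne_zero hne'.2) hdet).mono le_rfl ?_
      rintro s'' ⟨hA', ⟨F', G', hF', hG', hdet⟩, hsum⟩
      refine ⟨⟨fun a ha => (hA' a ha).trans (hA a ha), F', G', hF', hG', hdet⟩, ?_⟩
      norm_num at hsum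
      omega
  · rintro n s' ⟨hR, -⟩ he
    exact ⟨hR, he⟩
  -- The initial rows are `(u, 1, 0)` and `(v, 0, 1)`, with determinant `1` and total length `2 *
  -- W`.
  · refine ⟨⟨fun a ha => ?_, fun r => if r = 0 then u else if r = 1 then 1 else 0,
      fun r => if r = 0 then v else if r = 1 then 0 else 1, ⟨?_, ?_, ?_, ?_⟩, ⟨?_, ?_, ?_, ?_⟩,
      1, one_ne_zero, ?_⟩, ?_⟩
    · funext i
      simp [Store.write_apply, show a ≠ 12 by omega, show a ≠ 15 by omega, show a ≠ 16 by omega,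
        show a ≠ 17 by omega]
    · intro r hr i hi
      interval_cases r
      · simp [Store.write_apply, hu i hi]
      · by_cases h : i = 0 <;> simp [Store.write_apply, h, h0, coeff_one, ZMod.val_one]
      · simp [Store.write_apply, h0]
    · simp [Store.write_apply, width, hW]
    · simpa [Store.write_apply, width, hW] using hu'
    · simp
    · intro r hr i hi
      interval_cases r
      · simp [Store.write_apply, hv i hi]
      · simp [Store.write_apply, h0]
      · by_cases h : i = 0 <;> simp [Store.write_apply, h, h0, coeff_one, ZMod.val_one]
    · simp [Store.write_apply, width, hW]
    · simpa [Store.write_apply, width, hW] using hv'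
    · simp
    · simp
    · simp [Store.write_apply, width, hW]
      omega

/-- The cofactors are swapped and one is negated because `f * u + g * v = 0` means `u : v = g : -f`.
The final reduction modulo `p` turns `p - 0` into `0`. -/
theorem reaches_output {lam p r : ℕ} [NeZero p] {f g : (ZMod p)[X]} (hr : r < 2)
    (hp : s 0 1 = p) (hpL : p < 2 ^ L) (hlL : lam + 1 < 2 ^ L)
    (hf : ∀ i ≤ lam, s (12 + r) i = (f.coeff i).val)
    (hg : ∀ i ≤ lam, s (14 + r) i = (g.coeff i).val) :
    Reaches L (output lam r) s ((lam + 1) * 4 + 2) fun s' =>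
      (∀ i < 4, s' 2 i = s 2 i) ∧ (∀ i ≤ lam, s' 2 (4 + i) = (g.coeff i).val) ∧
        ∀ i ≤ lam, s' 2 (4 + (lam + 1) + i) = ((-f).coeff i).val := by
  refine Reaches.forLoop (k := 2) (fun j s' => s.Agree [2, 3] s' ∧ (∀ i < 4, s' 2 i = s 2 i) ∧
      (∀ i < j, s' 2 (4 + i) = (g.coeff i).val) ∧
        ∀ i < j, s' 2 (4 + (lam + 1) + i) = ((-f).coeff i).val) (lam + 1) hlL ?_ ?_ ?_ ?_
  · exact ⟨(Store.Agree.refl _ _).write _ _ (by simp), by simp [Store.write_apply], by simp,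
      by simp⟩
  · simp
  · rintro i s' hi h3 ⟨hA, hH, hG, hF⟩
    have h0 := hA 0 (by simp)
    have hf' : s' (12 + r) i = (f.coeff i).val := by
      rw [hA _ (by simp; omega)]; exact hf i (by omega)
    have hg' : s' (14 + r) i = (g.coeff i).val := by
      rw [hA _ (by simp; omega)]; exact hg i (by omega)
    have hneg : (p - (f.coeff i).val) % p = ((-f).coeff i).val := by
      rw [coeff_neg, ZMod.neg_val']
    refine Reaches.store_seq (k := 1) ?_ (Reaches.store ?_ ⟨?_, ?_, ?_, ?_, ?_⟩)
    · simp only [eval_load, eval_var, h3, hg']; exact (ZMod.val_lt _).trans hpL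
    · simp only [eval_mod, eval_load, eval_lit, eval_sub, eval_var, Store.write_apply, h3, h0, hp]
      exact (Nat.mod_lt _ (NeZero.pos p)).trans hpL
    · simp [Store.write_apply, h3]
    · exact ((hA.write _ _ (by simp)).write _ _ (by simp)).write _ _ (by simp)
    · intro j hj
      simp only [Store.write_apply, eval_add, eval_lit, eval_var, h3]
      simp [show j ≠ 4 + (lam + 1) + i by omega, show j ≠ 4 + i by omega, hH j hj]
    · intro j hj
      simp only [Store.write_apply, eval_add, eval_lit, eval_var, h3]
      rcases Nat.lt_succ_iff_lt_or_eq.mp hj with hj | rfl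
      · simp [show 4 + j ≠ 4 + (lam + 1) + i by omega, hj.ne, hG j hj]
      · simp [h3, hg']
    · intro j hj
      simp only [Store.write_apply, eval_add, eval_lit, eval_var, h3]
      rcases Nat.lt_succ_iff_lt_or_eq.mp hj with hj | rfl
      · simp [show 4 + (lam + 1) + j ≠ 4 + i by omega, hj.ne, hF j hj]
      · simp [show 12 + r ≠ 2 by omega, h3, h0, hp, hf', hneg, Store.write_apply]
  · rintro s' ⟨hA, hH, hG, hF⟩
    exact ⟨hH, fun i hi => hG i (by omega), fun i hi => hF i (by omega)⟩

end HPPK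

/-! ## The input and the output -/

/-- Row-major addressing; it is applied twice to locate a matrix entry in the encoded public key. -/
theorem List.getD_flatMap_of_length_eq {α : Type*} {l : List α} {g : α → List ℕ} {w : ℕ}
    (h : ∀ a ∈ l, (g a).length = w) {i j : ℕ} (hi : i < l.length) (hj : j < w) :
    (l.flatMap g).getD (i * w + j) 0 = (g l[i]).getD j 0 := by
  induction l generalizing i with
  | nil => simp at hi
  | cons a l ih =>
    have ha := h a (by simp)
    rw [List.flatMap_cons]
    rcases i with _ | i
    · rw [List.getD_append _ _ _ _ (by omega)]
      simp
    · rw [List.getD_append_right _ _ _ _ (by rw [ha, Nat.succ_mul]; omega), ha,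
        show (i + 1) * w + j - w = i * w + j by rw [Nat.succ_mul]; omega,
        ih (fun b hb => h b (by simp [hb])) (by simpa using hi)]
      simp

namespace RAM

theorem length_le_bitLength (l : List ℕ) : l.length ≤ bitLength l := by
  induction l with
  | nil => simp
  | cons a l ih =>
    simp only [bitLength, List.map_cons, List.sum_cons, List.length_cons] at *
    omega

theorem size_le_bitLength {l : List ℕ} {a : ℕ} (h : a ∈ l) : a.size ≤ bitLength l := by
  have := List.single_le_sum (l := l.map fun a => a.size + 1) (by simp) (a.size + 1)
    (List.mem_map.mpr ⟨a, h, rfl⟩)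
  exact (Nat.le_succ _).trans this

theorem size_arrayOf_le (l : List ℕ) (i : ℕ) : (arrayOf l i).size ≤ bitLength l := by
  rcases i with _ | i
  · refine (Nat.size_le.mpr ?_).trans (length_le_bitLength l)
    exact Nat.lt_two_pow_self
  · simp only [arrayOf, List.getD_cons_succ]
    rcases Nat.lt_or_ge i l.length with h | h
    · rw [List.getD_eq_getElem _ _ h]
      exact size_le_bitLength (List.getElem_mem h)
    · rw [List.getD_eq_default _ _ h]
      simp

theorem bounded_initStore {x y : List ℕ} {L : ℕ} (h : bitLength x + bitLength y ≤ L) :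
    (initStore x y : Store).Bounded L := by
  intro a i
  unfold initStore
  split_ifs
  · exact (size_arrayOf_le x i).trans (by omega)
  · exact (size_arrayOf_le y i).trans (by omega)
  · simp

end RAM

namespace HPPK

open RAM RAM.Expr RAM.Cmd

theorem PublicKey.length_encode (pk : PublicKey) :
    pk.encode.length = 3 + 2 * ((pk.n + 1) * pk.m) := by
  simp [PublicKey.encode, List.length_flatMap]
  omega

theorem PublicKey.arrayOf_encode (pk : PublicKey) (z : Fin 2) (i : Fin (pk.n + 1)) (j : Fin pk.m) :
    arrayOf pk.encode (4 + (z * ((pk.n + 1) * pk.m) + (i * pk.m + j))) = pk.P z i j := by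
  have hij : i.1 * pk.m + j < (pk.n + 1) * pk.m := by
    have := i.2
    nlinarith [j.2]
  unfold arrayOf PublicKey.encode
  rw [add_comm 4]
  simp only [List.cons_append, List.nil_append, List.getD_cons_succ]
  rw [List.getD_flatMap_of_length_eq _ (by simp; omega) hij,
    List.getD_flatMap_of_length_eq _ (by simp; omega) j.2]
  · simp
  · simp
  · simp [List.length_flatMap]

theorem PrivateKey.length_encode (lam : ℕ) {p : ℕ} (κ : PrivateKey p) :
    (κ.encode lam).length = 3 + 2 * (lam + 1) := by
  simp [PrivateKey.encode, HomKey.encode, List.length_flatMap]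
  omega

theorem PrivateKey.arrayOf_encode (lam : ℕ) {p : ℕ} (κ : PrivateKey p) {t : ℕ → ℕ}
    (h0 : t 0 = 3 + 2 * (lam + 1)) (h1 : t 1 = κ.S) (h2 : t 2 = κ.R 0) (h3 : t 3 = κ.R 1)
    (hf : ∀ i ≤ lam, t (4 + i) = ((κ.f 0).coeff i).val)
    (hf' : ∀ i ≤ lam, t (4 + (lam + 1) + i) = ((κ.f 1).coeff i).val) :
    ∀ i ≤ (κ.encode lam).length, t i = arrayOf (κ.encode lam) i := by
  intro i hi
  rw [κ.length_encode] at hi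
  unfold arrayOf
  rw [κ.length_encode]
  unfold PrivateKey.encode HomKey.encode
  rcases i with _ | _ | _ | _ | i
  · simpa using h0
  · simpa using h1
  · simpa using h2
  · simpa using h3
  · simp only [List.cons_append, List.nil_append, List.getD_cons_succ]
    rcases Nat.lt_or_ge i (lam + 1) with h | h
    · have := List.getD_flatMap_of_length_eq (l := List.finRange 2)
        (g := fun z => (List.range (lam + 1)).map fun i => ((κ.f z).coeff i).val) (w := lam + 1)
        (by simp) (i := 0) (j := i) (by simp) h
      rw [zero_mul, zero_add] at this
      rw [this, show i + 1 + 1 + 1 + 1 = 4 + i by omega, hf i (by omega)]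
      simp [h]
    · obtain ⟨j, rfl⟩ := Nat.exists_eq_add_of_le h
      have := List.getD_flatMap_of_length_eq (l := List.finRange 2)
        (g := fun z => (List.range (lam + 1)).map fun i => ((κ.f z).coeff i).val) (w := lam + 1)
        (by simp) (i := 1) (j := j) (by simp) (by omega)
      rw [one_mul] at this
      rw [this, show lam + 1 + j + 1 + 1 + 1 + 1 = 4 + (lam + 1) + j by omega, hf' j (by omega)]
      have hj : j < lam + 1 := by omega
      simp [hj]

/-! ## Private keys with the same homomorphic key -/

theorem decrypt_encrypt {S R V v : ℕ} (hV : V * R ≡ 1 [MOD S]) (hv : v < S) :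
    V * encrypt R S v % S = v := by
  have h : V * encrypt R S v ≡ v [MOD S] := by
    calc V * encrypt R S v ≡ V * (R * v) [MOD S] := (Nat.mod_modEq _ _).mul_left V
      _ = V * R * v := by ring
      _ ≡ 1 * v [MOD S] := hV.mul_right v
      _ = v := one_mul v
  exact (Nat.mod_eq_of_modEq h hv)

theorem IsGeneratedBy.lt_S {pk : PublicKey} {nb lam : ℕ} {κ : PrivateKey pk.p}
    {b : Fin pk.m → (ZMod pk.p)[X]} (h : IsGeneratedBy pk nb lam κ b) : pk.p < κ.S := by
  by_contra hc
  have h1 := Nat.size_le_size (not_lt.mp hc)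
  have h2 := h.size_S
  omega

/-- A coprime pair `g` in the same ratio as the polynomials `f` of a private key divides out a
common factor of `f`, and forms a private key with the same homomorphic key. -/
theorem IsGeneratedBy.exists_eq_mul {pk : PublicKey} {nb lam : ℕ} {h : HomKey}
    {f : Fin 2 → (ZMod pk.p)[X]} {b : Fin pk.m → (ZMod pk.p)[X]}
    (hgen : IsGeneratedBy pk nb lam ⟨h, f⟩ b) {g : Fin 2 → (ZMod pk.p)[X]} {z : Fin 2}
    (hf : f z ≠ 0) (hg : IsCoprime (g 0) (g 1)) (hfg : g 1 * f 0 = g 0 * f 1) :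
    (∃ e : (ZMod pk.p)[X], ∀ z, f z = e * g z) ∧ IsPrivateKey lam pk ⟨h, g⟩ := by
  have : Fact pk.p.Prime := ⟨hgen.prime⟩
  obtain ⟨α, β, hαβ⟩ := hg
  -- Multiply `α * g 0 + β * g 1 = 1` by `f z` and exchange factors with `g 1 * f 0 = g 0 * f 1`.
  have hmul : ∀ z, f z = (α * f 0 + β * f 1) * g z := by
    intro z
    fin_cases z
    · simp only [Fin.zero_eta]
      linear_combination (-f 0) * hαβ + β * hfg
    · simp only [Fin.mk_one]
      linear_combination (-f 1) * hαβ - α * hfg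
  set e := α * f 0 + β * f 1 with he
  have he0 : e ≠ 0 := fun h0 => hf (by rw [hmul z, h0, zero_mul])
  have hdeg : ∀ z, g z ≠ 0 → e.natDegree + (g z).natDegree ≤ lam := by
    intro z hz
    rw [← natDegree_mul he0 hz, ← hmul z]
    exact hgen.natDegree_f z
  have hgz : g z ≠ 0 := fun h0 => hf (by rw [hmul z, h0, mul_zero])
  have hlam := hdeg z hgz
  -- The factor `e` moves from `f` to `b`: all products `b j * f z` stay the same, and so does the
  -- sum of the two orders.
  refine ⟨⟨e, hmul⟩, lam - e.natDegree, Nat.sub_le _ _, nb + e.natDegree, fun j => b j * e,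
    ⟨hgen.prime, ?_, fun j => ?_, fun z => ?_, hgen.size_S, hgen.R_lt, hgen.coprime,
      fun z i j => ?_⟩⟩
  · have := hgen.order
    omega
  · exact natDegree_mul_le.trans (Nat.add_le_add_right (hgen.natDegree_b j) _)
  · by_cases hz : g z = 0
    · simp [hz]
    · have := hdeg z hz
      simp only
      omega
  · rw [hgen.cipher z i j]
    simp only [plainCoeff, mul_assoc, ← hmul z]

/-- A common divisor `e` of a coprime pair is a unit, hence a nonzero constant. -/
theorem exists_C_mul_of_isCoprime {p : ℕ} [Fact p.Prime] {f g : Fin 2 → (ZMod p)[X]}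
    {e : (ZMod p)[X]} (h : ∀ z, f z = e * g z) (hf : IsCoprime (f 0) (f 1)) :
    ∃ a : ZMod p, a ≠ 0 ∧ ∀ z, g z = C a * f z := by
  have hu : IsUnit e := hf.isUnit_of_dvd' ⟨g 0, h 0⟩ ⟨g 1, h 1⟩
  obtain ⟨c, hc, rfl⟩ := Polynomial.isUnit_iff.mp hu
  refine ⟨c⁻¹, inv_ne_zero hc.ne_zero, fun z => ?_⟩
  rw [h z, ← mul_assoc, ← C_mul, inv_mul_cancel₀ hc.ne_zero, C_1, one_mul]

/-! ## Correctness of the program -/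

/-- What the program achieves: `g` completes the homomorphic key to a private key, and divides the
given `f`. -/
def Completes (lam : ℕ) (pk : PublicKey) (h : HomKey) (f : Fin 2 → (ZMod pk.p)[X])
    (b : Fin pk.m → (ZMod pk.p)[X]) (g : Fin 2 → (ZMod pk.p)[X]) : Prop :=
  IsPrivateKey lam pk ⟨h, g⟩ ∧ (b ≠ 0 → ∃ e : (ZMod pk.p)[X], ∀ z, f z = e * g z)

/-- A zero entry means that `S` divides `R_z` times a residue less than `S`; as `R_z` is coprime to
`S`, the residue is `0`. So every `b j * f z` vanishes, and `b ≠ 0` forces `f = 0`. -/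
theorem IsGeneratedBy.completes_zero {pk : PublicKey} {nb lam lam' : ℕ} {h : HomKey}
    {f : Fin 2 → (ZMod pk.p)[X]} {b : Fin pk.m → (ZMod pk.p)[X]}
    (hgen : IsGeneratedBy pk nb lam' ⟨h, f⟩ b) (hlam : lam' ≤ lam) (h0 : ∀ z i j, pk.P z i j = 0) :
    Completes lam pk h f b 0 := by
  have : Fact pk.p.Prime := ⟨hgen.prime⟩
  refine ⟨⟨lam', hlam, nb, b, hgen.prime, hgen.order, hgen.natDegree_b, by simp, hgen.size_S,
    hgen.R_lt, hgen.coprime, by simp [h0, plainCoeff, encrypt]⟩, fun hb => ⟨0, fun z => ?_⟩⟩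
  obtain ⟨j, hj⟩ := Function.ne_iff.mp hb
  rw [zero_mul]
  refine (mul_eq_zero.mp (?_ : b j * f z = 0)).resolve_left hj
  ext i
  rw [coeff_zero]
  rcases Nat.lt_or_ge i (pk.n + 1) with hi | hi
  · have hS := hgen.lt_S
    have h1 := hgen.cipher z ⟨i, hi⟩ j
    rw [h0] at h1
    have hlt := (ZMod.val_lt (plainCoeff b f z i j)).trans hS
    have h2 := (hgen.coprime z).symm.dvd_of_dvd_mul_left (Nat.dvd_of_mod_eq_zero h1.symm)
    exact (ZMod.val_eq_zero _).mp (Nat.eq_zero_of_dvd_of_lt h2 hlt)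
  · refine coeff_eq_zero_of_natDegree_lt (natDegree_mul_le.trans_lt ?_)
    have h1 := hgen.natDegree_b j
    have h2 := hgen.natDegree_f z
    have h3 := hgen.order
    simp only at h2
    omega

end HPPK

/-! ### Assembly of the stages and the polynomial time bound -/

namespace HPPK

open RAM RAM.Expr RAM.Cmd

variable {L : ℕ} {s : Store}

theorem reaches_header (lam : ℕ) (hlam : 3 + 2 * (lam + 1) < 2 ^ L) (h : ∀ i, s 1 i < 2 ^ L) :
    Reaches L (header lam) s 4 fun s' => s.Agree [2] s' ∧ s' 2 0 = 3 + 2 * (lam + 1) ∧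
      s' 2 1 = s 1 1 ∧ s' 2 2 = s 1 2 ∧ s' 2 3 = s 1 3 ∧ ∀ i, 4 ≤ i → s' 2 i = s 2 i := by
  refine Reaches.store_seq (k := 3) hlam (Reaches.store_seq (k := 2) ?_ (Reaches.store_seq
    (k := 1) ?_ (Reaches.store ?_ ⟨?_, ?_, ?_, ?_, ?_, fun i hi => ?_⟩)))
  · exact h 1
  · simpa [Store.write_apply] using h 2
  · simpa [Store.write_apply] using h 3
  · repeat' first | exact .refl _ _ | refine Store.Agree.write ?_ _ _ (by simp)
  all_goals simp [Store.write_apply]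
  rw [if_neg (by omega), if_neg (by omega), if_neg (by omega), if_neg (by omega)]

/-- The number of steps of the whole program, when `L` bounds the bit length of the input. -/
def stepBound (L : ℕ) : ℕ := 10 * L * L + 100 * L + 100

theorem reaches_extract {pk : PublicKey} {nb lam lam' : ℕ} {h : HomKey}
    {f : Fin 2 → (ZMod pk.p)[X]} {b : Fin pk.m → (ZMod pk.p)[X]}
    (hgen : IsGeneratedBy pk nb lam' ⟨h, f⟩ b) (hlam : lam' ≤ lam)
    (hin : s 0 = arrayOf pk.encode) (hkey : s 1 = arrayOf h.encode)
    (hzero : ∀ a, 5 ≤ a → ∀ i, s a i = 0) {i₀ : ℕ} (hi₀ : i₀ < 2 * ((pk.n + 1) * pk.m))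
    (hne : arrayOf pk.encode (4 + i₀) ≠ 0) (h4 : s 4 0 = i₀ % pk.m + 1)
    (hL : bitLength pk.encode + bitLength h.encode + 2 * lam + 10 ≤ L) :
    Reaches L (.seq (invert 0) (.seq (decrypt 0) (.seq (invert 1) (.seq (decrypt 1)
      (.seq (euclid lam) (.cond (var 17) (output lam 0) (output lam 1))))))) s
      (10 * L * L + 94 * L + 70) fun s' => ∃ g, Completes lam pk h f b g ∧
        (∀ i < 4, s' 2 i = s 2 i) ∧ (∀ i ≤ lam, s' 2 (4 + i) = ((g 0).coeff i).val) ∧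
        ∀ i ≤ lam, s' 2 (4 + (lam + 1) + i) = ((g 1).coeff i).val := by
  have hpP : Fact pk.p.Prime := ⟨hgen.prime⟩
  have hlen := length_le_bitLength pk.encode
  rw [pk.length_encode] at hlen
  have hm : 0 < pk.m := by
    rcases Nat.eq_zero_or_pos pk.m with hm | hm
    · simp [hm] at hi₀
    · exact hm
  have hnm : pk.n + 1 ≤ (pk.n + 1) * pk.m := Nat.le_mul_of_pos_right _ hm
  have hpow : ∀ v, v ≤ L → v < 2 ^ L := fun v hv => hv.trans_lt Nat.lt_two_pow_self
  have hpL : pk.p < 2 ^ L := Nat.size_le.mp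
    ((size_le_bitLength (l := pk.encode) (by simp [PublicKey.encode])).trans (by omega))
  have hSL : h.S < 2 ^ L := Nat.size_le.mp
    ((size_le_bitLength (l := h.encode) (by simp [HomKey.encode])).trans (by omega))
  have hpS := hgen.lt_S
  simp only at hpS
  have e01 : s 0 1 = pk.p := by rw [hin]; rfl
  have e02 : s 0 2 = pk.n := by rw [hin]; rfl
  have e03 : s 0 3 = pk.m := by rw [hin]; rfl
  have e11 : s 1 1 = h.S := by rw [hkey]; rfl
  have e12 : s 1 2 = h.R 0 := by rw [hkey]; rfl
  have e13 : s 1 3 = h.R 1 := by rw [hkey]; rfl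
  set j : Fin pk.m := ⟨i₀ % pk.m, Nat.mod_lt _ hm⟩ with hj
  have hP : ∀ (z : Fin 2) (i : ℕ) (hi : i < pk.n + 1),
      s 0 (3 + z * ((pk.n + 1) * pk.m) + i * pk.m + (i₀ % pk.m + 1)) =
        encrypt (h.R z) h.S ((b j * f z).coeff i).val := by
    intro z i hi
    have h1 := pk.arrayOf_encode z ⟨i, hi⟩ j
    rw [hgen.cipher] at h1
    simp only [plainCoeff] at h1
    rw [hin, ← h1]
    congr 1
    simp only [hj]
    omega
  have hdeg : ∀ z i, pk.n < i → (b j * f z).coeff i = 0 := by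
    intro z i hi
    refine coeff_eq_zero_of_natDegree_lt (natDegree_mul_le.trans_lt ?_)
    have h1 := hgen.natDegree_b j
    have h2 := hgen.natDegree_f z
    have h3 := hgen.order
    simp only at h2
    omega
  -- Division with remainder splits `i₀` into matrix, row and column; a zero product would have
  -- encrypted to a zero entry there.
  have hbf : ∃ z, b j * f z ≠ 0 := by
    have hz : i₀ / ((pk.n + 1) * pk.m) < 2 := Nat.div_lt_of_lt_mul (by linarith)
    have hr : i₀ % ((pk.n + 1) * pk.m) / pk.m < pk.n + 1 :=
      Nat.div_lt_of_lt_mul (by rw [mul_comm]; exact Nat.mod_lt _ (by positivity))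
    have h1 := pk.arrayOf_encode ⟨_, hz⟩ ⟨_, hr⟩ j
    have h2 := Nat.div_add_mod i₀ ((pk.n + 1) * pk.m)
    have h3 := Nat.div_add_mod (i₀ % ((pk.n + 1) * pk.m)) pk.m
    rw [Nat.mod_mul_left_mod] at h3
    have h5 : i₀ / ((pk.n + 1) * pk.m) * ((pk.n + 1) * pk.m) +
        (i₀ % ((pk.n + 1) * pk.m) / pk.m * pk.m + i₀ % pk.m) = i₀ := by linarith
    simp only [hj, h5] at h1
    refine ⟨⟨_, hz⟩, fun h0 => hne ?_⟩
    rw [h1, hgen.cipher]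
    simp only [plainCoeff]
    rw [← hj, h0]
    simp [encrypt]
  set W := pk.n + (lam + 1) with hW
  have hWL : W < 2 ^ L := hpow _ (by omega)
  have hnL : pk.n + 1 < 2 ^ L := hpow _ (by omega)
  set F := [3, 5, 6, 7, 8, 9, 10, 11] with hF
  -- Inversion and decryption for either `z`, with the rest of the program as a continuation `c`;
  -- the untouched zeros above index `n` agree with the coefficients because of `hdeg`.
  have hstage : ∀ (z : Fin 2) (t : Store) (c : Cmd) (k : ℕ) (Q : Store → Prop), s.Agree F t →
      (∀ i, t (10 + z) i = 0) →
      (∀ t', s.Agree F t' → (∀ i < W, t' (10 + z) i = ((b j * f z).coeff i).val) →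
        (∀ a : ℕ, 10 ≤ a → a ≠ 10 + z → t' a = t a) → Reaches L c t' k Q) →
      Reaches L (.seq (invert z) (.seq (decrypt z) c)) t
        (2 * L * 7 + 5 + ((pk.n + 1) * 3 + 2 + k)) Q := by
    intro z t c k Q hA h0 hc
    have hz := z.2
    refine Reaches.seq (reaches_invert (S := h.S) (R := h.R z) (by rw [hA 1 (by simp [hF]), e11])
      ?_ (hgen.R_lt z) (hgen.coprime z) hSL) ?_
    · rw [hA 1 (by simp [hF])]
      obtain rfl | rfl : z = 0 ∨ z = 1 := by omega
      · exact e12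
      · exact e13
    rintro s₁ ⟨hA₁, hV⟩
    have hs₁ : ∀ a < 5, a ≠ 3 → s₁ a = s a := fun a ha ha3 =>
      (hA₁ a (by simp; omega)).trans (hA a (by simp [hF]; omega))
    refine Reaches.seq ((reaches_decrypt hz ?_ ?_ ?_).mono
      (le_of_eq (by rw [hs₁ 0 (by omega) (by omega), e02])) fun _ h => h) ?_
    · rw [hs₁ 1 (by omega) (by omega), e11]; omega
    · rw [hs₁ 1 (by omega) (by omega), e11]; exact hSL
    · rw [hs₁ 0 (by omega) (by omega), e02]; exact hnL
    rintro s₂ ⟨hA₂, hd, hd'⟩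
    rw [hs₁ 0 (by omega) (by omega), hs₁ 1 (by omega) (by omega), hs₁ 4 (by omega) (by omega), e02,
      e03, e11, h4] at hd
    rw [hs₁ 0 (by omega) (by omega), e02] at hd'
    refine hc s₂ (fun a ha => ?_) (fun i hi => ?_) (fun a ha ha' => ?_)
    · simp only [hF, List.mem_cons, List.not_mem_nil, or_false, not_or] at ha
      rw [hA₂ a (by simp; omega), hA₁ a (by simp; omega), hA a (by simp [hF]; omega)]
    · rcases Nat.lt_or_ge pk.n i with h1 | h1
      · rw [hd' i h1, hA₁ _ (by simp; omega), h0, hdeg z i h1, ZMod.val_zero]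
      · rw [hd i h1, hP z i (by omega), decrypt_encrypt hV ((ZMod.val_lt _).trans hpS)]
    · rw [hA₂ a (by simp; omega), hA₁ a (by simp; omega)]
  refine (hstage 0 s _ (2 * L * 7 + 5 + ((pk.n + 1) * 3 + 2 +
      (2 * W * (W * 5 + 8) + 5 + ((lam + 1) * 4 + 2 + 1)))) _ (.refl _ _) (hzero _ (by omega))
      ?_).mono ?_ fun _ h => h
  swap
  · have hW' : W ≤ L := by omega
    have h1 : W * W ≤ L * L := Nat.mul_le_mul hW' hW'
    have h2 : pk.n + 1 ≤ L := by omega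
    have h3 : lam + 1 ≤ L := by omega
    nlinarith
  intro s₁ hA₁ hu₁ h0₁
  refine hstage 1 s₁ _ _ _ hA₁ (fun i => ?_) ?_
  · rw [h0₁ _ (by simp) (by simp), hzero _ (by simp)]
  intro s₂ hA₂ hu₂ h0₂
  have hout : ∀ i, s₂ 2 i = s 2 i := fun i => by rw [hA₂ 2 (by simp [hF])]
  have e01' : s₂ 0 1 = pk.p := by rw [hA₂ 0 (by simp [hF]), e01]
  refine Reaches.seq (reaches_euclid (W := W) (u := b j * f 0) (v := b j * f 1) e01'
    (by rw [hA₂ 0 (by simp [hF]), e02]) hpL hWL (fun i hi => ?_) hu₂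
    (fun i hi => hdeg 0 i (by omega)) (fun i hi => hdeg 1 i (by omega)) (fun a ha ha' i => ?_)) ?_
  · rw [← hu₁ i hi, h0₂ 10 le_rfl (by simp)]; rfl
  · rw [hA₂ a (by simp [hF]; omega), hzero a (by omega)]
  rintro s₃ ⟨⟨hA₃, G, H, hG, hH, e, he, hdet⟩, h67⟩
  have hbj : b j ≠ 0 := by
    rintro h0
    simp [h0] at hbf
  obtain ⟨z₀, hz₀⟩ := hbf
  have hfz : f z₀ ≠ 0 := right_ne_zero_of_mul hz₀
  have hC : (C e⁻¹ : (ZMod pk.p)[X]) * C e = 1 := by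
    rw [← C_mul, inv_mul_cancel₀ he, C_1]
  -- Any coprime syzygy yields a key. The bound `lam` on its degrees follows from divisibility of
  -- `f`, so the `lam + 1` coefficients that are output determine it.
  have hcomp : ∀ x y : (ZMod pk.p)[X], x * (b j * f 0) + y * (b j * f 1) = 0 →
      IsCoprime x y → Completes lam pk h f b ![y, -x] := by
    intro x y hxy hco
    obtain ⟨h1, h2⟩ := hgen.exists_eq_mul (g := ![y, -x]) hfz
      (by simpa using hco.symm.neg_right)
      (by
        refine mul_left_cancel₀ hbj ?_
        simp only [Matrix.cons_val_zero, Matrix.cons_val_one]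
        linear_combination -hxy)
    obtain ⟨l, hl, hk⟩ := h2
    exact ⟨⟨l, hl.trans hlam, hk⟩, fun _ => h1⟩
  have e01'' : s₃ 0 1 = pk.p := by rw [hA₃ 0 (by omega), e01']
  have hlL : lam + 1 < 2 ^ L := hpow _ (by omega)
  refine Reaches.cond (fun h7 => ?_) (fun h7 => ?_)
  · have h6 : s₃ 16 0 = 0 := by
      rw [eval_var] at h7
      simpa [h7] using h67
    have hG0 : G 0 = 0 := by
      ext i
      rw [coeff_zero]
      exact hG.coeff_eq_zero i (by simp [h6])
    refine (reaches_output (f := G 1) (g := G 2) (by omega) e01'' hpL hlL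
      (fun i hi => hG.rep 1 (by omega) i (by omega))
      (fun i hi => hG.rep 2 (by omega) i (by omega))).mono le_rfl ?_
    rintro s₄ ⟨h1, h2, h3⟩
    -- The determinant divided by the constant `e` is a Bézout identity for the cofactors, with the
    -- other row as coefficients.
    refine ⟨![G 2, -G 1], hcomp _ _ (by rw [← hG.relation, hG0]) ⟨C e⁻¹ * H 2, -(C e⁻¹ * H 1), ?_⟩,
      fun i hi => by rw [h1 i hi, hA₃ 2 (by omega), hout], by simpa using h2, by simpa using h3⟩
    linear_combination C e⁻¹ * hdet + hC
  · rw [eval_var] at h7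
    have hH0 : H 0 = 0 := by
      ext i
      rw [coeff_zero]
      exact hH.coeff_eq_zero i (by simp [h7])
    refine (reaches_output (f := H 1) (g := H 2) (by omega) e01'' hpL hlL
      (fun i hi => hH.rep 1 (by omega) i (by omega))
      (fun i hi => hH.rep 2 (by omega) i (by omega))).mono le_rfl ?_
    rintro s₄ ⟨h1, h2, h3⟩
    refine ⟨![H 2, -H 1], hcomp _ _ (by rw [← hH.relation, hH0]) ⟨-(C e⁻¹ * G 2), C e⁻¹ * G 1, ?_⟩,
      fun i hi => by rw [h1 i hi, hA₃ 2 (by omega), hout], by simpa using h2, by simpa using h3⟩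
    linear_combination C e⁻¹ * hdet + hC

theorem reaches_program {pk : PublicKey} {nb lam lam' : ℕ} {h : HomKey}
    {f : Fin 2 → (ZMod pk.p)[X]} {b : Fin pk.m → (ZMod pk.p)[X]}
    (hgen : IsGeneratedBy pk nb lam' ⟨h, f⟩ b) (hlam : lam' ≤ lam)
    (hL : bitLength pk.encode + bitLength h.encode + 2 * lam + 10 ≤ L) :
    Reaches L (program lam) (initStore pk.encode h.encode) (stepBound L) fun s' =>
      ∃ g, Completes lam pk h f b g ∧
        ∀ i ≤ (PrivateKey.encode lam ⟨h, g⟩).length,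
          s' 2 i = arrayOf (PrivateKey.encode lam ⟨h, g⟩) i := by
  set s := initStore pk.encode h.encode with hs
  have hB : s.Bounded L := bounded_initStore (by omega)
  have hpow : ∀ v, v ≤ L → v < 2 ^ L := fun v hv => hv.trans_lt Nat.lt_two_pow_self
  have hlen := length_le_bitLength pk.encode
  rw [pk.length_encode] at hlen
  have e0 : s 0 = arrayOf pk.encode := rfl
  have e1 : s 1 = arrayOf h.encode := rfl
  have ez : ∀ a, 2 ≤ a → ∀ i, s a i = 0 := by
    intro a ha i
    simp [hs, initStore, show a ≠ 0 by omega, show a ≠ 1 by omega]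
  refine (Reaches.seq (k₂ := 2 * ((pk.n + 1) * pk.m) * 4 + 2 + (10 * L * L + 94 * L + 70 + 1))
    (reaches_header lam (hpow _ (by omega)) fun i => Nat.size_le.mp (hB 1 i)) ?_).mono
    (by unfold stepBound; nlinarith) fun _ h => h
  rintro s₁ ⟨hA₁, o0, o1, o2, o3, o4⟩
  refine Reaches.seq (reaches_scan (N := 2 * ((pk.n + 1) * pk.m))
    (by rw [hA₁ 4 (by simp), ez 4 (by omega)]) (by rw [hA₁ 0 (by simp)]; rfl)
    (hpow _ (by omega))) ?_
  rintro s₂ ⟨hA₂, hscan⟩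
  rw [hA₁ 0 (by simp), e0] at hscan
  have e02 : s₂ 0 = arrayOf pk.encode := by rw [hA₂ 0 (by simp), hA₁ 0 (by simp)]; rfl
  have e12 : s₂ 1 = arrayOf h.encode := by rw [hA₂ 1 (by simp), hA₁ 1 (by simp)]; rfl
  have e22 : s₂ 2 = s₁ 2 := hA₂ 2 (by simp)
  refine Reaches.cond (fun h4 => ?_) (fun h4 => ?_)
  · rw [eval_var] at h4
    obtain ⟨i₀, hi₀, hne, h4'⟩ := hscan.resolve_left fun hc => h4 hc.1
    refine (reaches_extract hgen hlam e02 e12 (fun a ha i => ?_) hi₀ hne h4' hL).mono le_rfl ?_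
    · rw [hA₂ a (by simp; omega), hA₁ a (by simp; omega), ez a (by omega)]
    · rintro s' ⟨g, hg, hlow, h0, h1⟩
      rw [e22] at hlow
      exact ⟨g, hg, PrivateKey.arrayOf_encode lam ⟨h, g⟩ ((hlow 0 (by omega)).trans o0)
        ((hlow 1 (by omega)).trans o1) ((hlow 2 (by omega)).trans o2)
        ((hlow 3 (by omega)).trans o3) h0 h1⟩
  · rw [eval_var] at h4
    have hzero : ∀ i < 2 * ((pk.n + 1) * pk.m), arrayOf pk.encode (4 + i) = 0 := by
      rcases hscan with hscan | ⟨i, _, _, hi⟩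
      · exact hscan.2
      · omega
    have hP0 : ∀ z i j, pk.P z i j = 0 := by
      intro z i j
      rw [← pk.arrayOf_encode z i j]
      refine hzero _ ?_
      have h1 : i.1 * pk.m + j < (pk.n + 1) * pk.m := by nlinarith [i.2, j.2]
      have h2 : z.1 * ((pk.n + 1) * pk.m) ≤ 1 * ((pk.n + 1) * pk.m) :=
        Nat.mul_le_mul_right _ (by omega)
      omega
    -- Without a nonzero entry only the header is written; the initial zeros of the output array
    -- already encode `g = 0`.
    refine (Reaches.skip ⟨0, hgen.completes_zero hlam hP0, PrivateKey.arrayOf_encode lam ⟨h, 0⟩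
      (by rw [e22]; exact o0) (by rw [e22]; exact o1) (by rw [e22]; exact o2)
      (by rw [e22]; exact o3) (fun i _ => ?_) (fun i _ => ?_)⟩).mono (by omega) fun _ h => h
    · rw [e22, o4 _ (by omega), ez 2 le_rfl]; simp
    · rw [e22, o4 _ (by omega), ez 2 le_rfl]; simp

/-- A polynomial bound for the running time, given a bound for the cost of a step. -/
noncomputable def timeBound (lam K : ℕ) : ℕ[X] :=
  (10 * (X + C (2 * lam + 10)) * (X + C (2 * lam + 10)) + 100 * (X + C (2 * lam + 10)) + 100) *
    (C K * (X + C (2 * lam + 10) + 1) ^ 2)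

theorem eval_timeBound (lam K l : ℕ) : (timeBound lam K).eval l =
    stepBound (l + (2 * lam + 10)) * (K * (l + (2 * lam + 10) + 1) ^ 2) := by
  simp [timeBound, stepBound]

theorem computesWithin_program (lam : ℕ) : ∃ q : ℕ[X], ∀ (pk : PublicKey) (nb lam' : ℕ) (h : HomKey)
    (f : Fin 2 → (ZMod pk.p)[X]) (b : Fin pk.m → (ZMod pk.p)[X]),
    IsGeneratedBy pk nb lam' ⟨h, f⟩ b → lam' ≤ lam → ∃ g, Completes lam pk h f b g ∧
      ComputesWithin (program lam) pk.encode h.encode (PrivateKey.encode lam ⟨h, g⟩)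
        (q.eval (bitLength pk.encode + bitLength h.encode)) := by
  -- `K` is fixed before the input, so it may enter the coefficients of the polynomial.
  obtain ⟨K, hK⟩ := (program lam).exists_cost_le
  refine ⟨timeBound lam K, fun pk nb lam' h f b hgen hlam => ?_⟩
  obtain ⟨k, hk, s', hs', g, hg, hout⟩ := reaches_program hgen hlam le_rfl
  obtain ⟨t, ht, hE⟩ := hK _ _ _ _ hs' (bounded_initStore (by omega))
  refine ⟨g, hg, t, s', hE, ht.trans ?_, hout⟩
  rw [eval_timeBound, ← add_assoc]
  exact Nat.mul_le_mul_right _ hk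

end HPPK

theorem mainTheorem6 (lam : ℕ) (hlam : lam ≤ 2) :
    ∃ (c : RAM.Cmd) (q : Polynomial ℕ),
      ReducesBy HPPK.PublicKey.encode c q
        (HPPK.privateKeyProblem lam) (HPPK.homKeyProblem lam) ∧
      ∀ (pk : HPPK.PublicKey) (nb : ℕ) (κ : HPPK.PrivateKey pk.p)
        (b : Fin pk.m → Polynomial (ZMod pk.p)),
        HPPK.IsGeneratedBy pk nb lam κ b → b ≠ 0 →
        ∃ g : Fin 2 → Polynomial (ZMod pk.p),
          HPPK.IsPrivateKey lam pk ⟨κ.toHomKey, g⟩ ∧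
          RAM.ComputesWithin c pk.encode κ.toHomKey.encode
            (HPPK.PrivateKey.encode lam ⟨κ.toHomKey, g⟩)
            (q.eval (RAM.bitLength pk.encode + RAM.bitLength κ.toHomKey.encode)) ∧
          (∃ e : Polynomial (ZMod pk.p), ∀ z, κ.f z = e * g z) ∧
          (IsCoprime (κ.f 0) (κ.f 1) →
            ∃ a : ZMod pk.p, a ≠ 0 ∧ ∀ z, g z = Polynomial.C a * κ.f z) := by
  obtain ⟨q, hq⟩ := HPPK.computesWithin_program lam
  refine ⟨HPPK.program lam, q, ⟨?_, ?_⟩, ?_⟩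
  · rintro pk ⟨κ, hκ⟩
    exact ⟨κ.toHomKey, κ.f, hκ⟩
  · rintro pk h ⟨f, lam', hle, nb, b, hgen⟩
    obtain ⟨g, hg, hc⟩ := hq pk nb lam' h f b hgen hle
    exact ⟨⟨h, g⟩, hg.1, hc⟩
  · intro pk nb κ b hgen hb
    have : Fact pk.p.Prime := ⟨hgen.prime⟩
    obtain ⟨g, hg, hc⟩ := hq pk nb lam κ.toHomKey κ.f b hgen le_rfl
    obtain ⟨e, he⟩ := hg.2 hb
    exact ⟨g, hg.1, hc, ⟨e, he⟩, HPPK.exists_C_mul_of_isCoprime he⟩
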